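/- There is an absolute constant $c>0$ such that for every $\lambda\in(0,1)$ there is a sequence $(\delta_n)_{n\ge 1}$ of real numbers with $\delta_n\to 0$ as $n\to\infty$ for which the following holds. Let $n\ge 2$, let $p,\eta\in[0,1]$ satisfy $p\ge \frac{1.5\log n}{n}$ and $p\eta\le\frac{\lambda}{n}$ (the subcritical regime), and let $s\ne t$ be vertices in $V=\{1,\dots,n\}$. Let the ground truth graph be $G^*\sim \mathrm{ER}(n,p)$, the random graph on $V$ in which every pair is an edge independently with probability $p$, and let the prior graph $G$ be obtained from $G^*$ by keeping each edge independently with probability $\eta$. Consider any (possibly randomized and adaptive) algorithm that knows $n,p,\eta,s,t$ and the graph $G$ and that accesses $G^*$ only through connected component incident retrieval queries: on a query $v\in V$ the oracle returns the set $$S_v=\{(u,w): \{u,w\}\in E(G^*),\ u\in C_G(v),\ w\notin C_G(v)\},$$ where $C_G(v)$ is the vertex set of the connected component of $G$ that contains $v$, or the symbol $\bot$ if $S_v=\emptyset$. The algorithm finally outputs a sequence of vertices, which may use edges that it has not observed; it succeeds if this sequence is a simple path from $s$ to $t$ in $G^*$. Then either the algorithm makes at least $$\frac{c}{p\cdot \log^2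 n\cdot\sqrt n}$$ queries in expectation, or it succeeds with probability at most $p\log^2 n+\delta_n$. Both the expectation and the probability are over $G^*$, $G$ and the internal randomness of the algorithm. -/

import Mathlib

open MeasureTheory Filter Topology
open scoped ENNReal

namespace PathQuery

/-- The set `S_v` of edges `(u, w)` of the ground truth graph `Gstar` that leave the connected
component of `v` in the prior graph `G`: `u` lies in that component and `w` does not. -/
def cciEdges {V : Type} (Gstar G : SimpleGraph V) (v : V) : Set (V × V) :=
  {e | Gstar.Adj e.1 e.2 ∧ e.1 ∈ (G.connectedComponentMk v).supp ∧
    e.2 ∉ (G.connectedComponentMk v).supp}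

open Classical in
/-- The connected component incident (CCI) retrieval oracle: it answers `v` with `S_v`,
or with `⊥` (here `none`) if `S_v` is empty. -/
noncomputable def cciOracle {V : Type} (Gstar G : SimpleGraph V) (v : V) :
    Option (Set (V × V)) :=
  if (cciEdges Gstar G v).Nonempty then some (cciEdges Gstar G v) else none

/-- A deterministic adaptive query strategy: either stop and output a list of vertices (the
proposed path), or query a vertex and continue depending on the answer of the oracle. -/
inductive Strategy (V : Type) : Type
  | output (l : List V) : Strategy V
  | query (v : V) (next : Option (Set (V × V)) → Strategy V) : Strategy V

/-- The output of a strategy when its queries are answered by the oracle `O`. -/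
def Strategy.run {V : Type} (O : V → Option (Set (V × V))) : Strategy V → List V
  | .output l => l
  | .query v next => (next (O v)).run O

/-- The number of queries that a strategy makes when they are answered by the oracle `O`. -/
def Strategy.numQueries {V : Type} (O : V → Option (Set (V × V))) : Strategy V → ℕ
  | .output _ => 0
  | .query v next => (next (O v)).numQueries O + 1

/-- A deterministic algorithm on the vertex set `Fin n`: it sees the whole prior graph and then
follows a query strategy. It may output arbitrary edges (it need not be grounded). -/
abbrev Algorithm (n : ℕ) : Type := SimpleGraph (Fin n) → Strategy (Fin n)

/-- A randomized algorithm: a random choice of a deterministic algorithm, made independently of the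
graphs. (There are only countably many deterministic algorithms for each `n`, so every probability
distribution on them is given by a probability mass function.) -/
abbrev RandomizedAlgorithm (n : ℕ) : Type := PMF (Algorithm n)

/-- The probability space of the pair of graphs. A sample point is a pair `ω = (Gstar, H)` of
independent graphs `Gstar ∼ ER(n, p)` and `H ∼ ER(n, η)`; the graph `H` is the mask that
decides which edges are kept. -/
noncomputable def graphLaw (n : ℕ) (p η : unitInterval) :
    Measure (SimpleGraph (Fin n) × SimpleGraph (Fin n)) :=
  (SimpleGraph.binomialRandom (Fin n) p).prod (SimpleGraph.binomialRandom (Fin n) η)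

/-- The ground truth graph `G*`. -/
def truth {n : ℕ} (ω : SimpleGraph (Fin n) × SimpleGraph (Fin n)) : SimpleGraph (Fin n) := ω.1

/-- The prior graph `G`: the edges of `G*` that are kept, each independently with
probability `η`. -/
def prior {n : ℕ} (ω : SimpleGraph (Fin n) × SimpleGraph (Fin n)) : SimpleGraph (Fin n) :=
  ω.1 ⊓ ω.2

/-- The list `l` is the sequence of vertices of a simple path from `s` to `t` in `Gstar`. -/
def IsPathList {V : Type} (Gstar : SimpleGraph V) (s t : V) (l : List V) : Prop :=
  ∃ P : Gstar.Walk s t, P.IsPath ∧ P.support = l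

/-- The probability, over both graphs and the internal randomness of the algorithm, that the output
is a simple path from `s` to `t` in `G*`. -/
noncomputable def successProb {n : ℕ} (p η : unitInterval) (s t : Fin n)
    (A : RandomizedAlgorithm n) : ℝ≥0∞ :=
  ∑' a : Algorithm n, A a * graphLaw n p η
    {ω | IsPathList (truth ω) s t ((a (prior ω)).run (cciOracle (truth ω) (prior ω)))}

/-- The expected number of CCI queries, over both graphs and the internal randomness of the
algorithm. -/
noncomputable def expectedQueries {n : ℕ} (p η : unitInterval)
    (A : RandomizedAlgorithm n) : ℝ≥0∞ :=
  ∑' a : Algorithm n, A a * ∫⁻ ω,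
    ((a (prior ω)).numQueries (cciOracle (truth ω) (prior ω)) : ℝ≥0∞) ∂(graphLaw n p η)

end PathQuery

/-!
The argument is a birthday bound. Write `L` for the largest size of a component of the prior graph
`G`. Since `p * η ≤ lam / n` with `lam < 1`, exploring a component is dominated by a subcritical
branching process, whose total progeny has an exponential moment
(`sum_mul_pow_ncard_reachedFrom_le`). Hence `L` is of order `log n` with high probability
(`pairProb_largeComponent_le`), and by exchangeability `G` connects two given vertices with
probability of order `1 / n` (`pairProb_reachable_le`).

Condition on `G` and on the edges of `Gstar` at the vertices queried so far. Every other pair which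
is not an edge of `G` is an edge of `Gstar` with conditional probability at most `p`
(`sum_infoEvent_adj_le`). Suppose that `s` and `t` are not yet connected by the observed edges, and
let `Y` be the set of seen vertices. An output now has to guess an edge, so it succeeds with
probability at most `p`. A query of a component `C` can connect `s` with `t` only if it reveals an
edge between `C` and `Y \ C`, an event of probability at most `p * L * |Y|`
(`Unconnected.query`); and it enlarges `Y` by at most `L + L * (L * n * p)` vertices in expectation.
Since the bound on the success probability is linear in `|Y|`, an induction on the strategy shows
that `k` queries succeed with probability at most
`p + k * (p * L * |Y|) + k ^ 2 * (p * L * (L + L * (L * n * p)))`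
(`pairProb_successWithin_le`).

With `L` of order `log n` and `k` at most `M / (p * (log n) ^ 2 * √n)`, the last two terms are of
order `1 / M`, where `M = (log n) ^ (1 / 4)` (`connection_bound`). Markov's inequality passes from
the expected number of queries to the bound `k` at the cost of another `1 / M`
(`successProb_le`).
-/

namespace PathQuery

/-! ### Edges of a random graph -/

section Weights

variable {V : Type}

/-- The probability of a single graph under `ER(V, p)`. -/
noncomputable def erWeight (p : unitInterval) (Γ : SimpleGraph V) : ℝ :=
  (SimpleGraph.binomialRandom V p).real {Γ}

theorem erWeight_nonneg (p : unitInterval) (Γ : SimpleGraph V) : 0 ≤ erWeight p Γ :=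
  measureReal_nonneg

variable [Fintype V]

theorem erWeight_eq (p : unitInterval) (Γ : SimpleGraph V) :
    erWeight p Γ = (p : ℝ) ^ Γ.edgeSet.ncard *
      (1 - p : ℝ) ^ ((Nat.card V).choose 2 - Γ.edgeSet.ncard) := by
  simp [erWeight, measureReal_def, SimpleGraph.binomialRandom_singleton]

theorem erWeight_comap_equiv (p : unitInterval) (σ : Equiv.Perm V) (Γ : SimpleGraph V) :
    erWeight p (Γ.comap σ) = erWeight p Γ := by
  classical
  have h := (SimpleGraph.Iso.comap σ Γ).card_edgeFinset_eq
  have h' : (Γ.comap σ).edgeSet.ncard = Γ.edgeSet.ncard := by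
    rw [Set.ncard_eq_toFinset_card', Set.ncard_eq_toFinset_card']
    exact h
  rw [erWeight_eq, erWeight_eq, h']

variable [DecidableEq V]

theorem discreteMeasurableSpace_simpleGraph : DiscreteMeasurableSpace (SimpleGraph V) := by
  have h : MeasurableSingletonClass (SimpleGraph V) := ⟨fun Γ => by
    have := (SimpleGraph.measurable_edgeSet (V := V)) (measurableSet_singleton Γ.edgeSet)
    convert this using 1
    ext Δ
    simp⟩
  infer_instance

theorem sum_erWeight (p : unitInterval) : ∑ Γ : SimpleGraph V, erWeight p Γ = 1 := by
  have := discreteMeasurableSpace_simpleGraph (V := V)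
  simp [erWeight, sum_measureReal_singleton]

theorem erWeight_mul_sup_edge (p : unitInterval) {a b : V} (hab : a ≠ b) {Γ : SimpleGraph V}
    (h : ¬ Γ.Adj a b) :
    (1 - p : ℝ) * erWeight p (Γ ⊔ SimpleGraph.edge a b) = p * erWeight p Γ := by
  classical
  have h1 : (Γ ⊔ SimpleGraph.edge a b).edgeSet.ncard = Γ.edgeSet.ncard + 1 := by
    rw [SimpleGraph.edgeSet_sup, SimpleGraph.edgeSet_edge_of_ne hab, Set.union_singleton,
      Set.ncard_insert_of_notMem (by simpa using h)]
  have h2 : (Γ ⊔ SimpleGraph.edge a b).edgeSet.ncard ≤ (Nat.card V).choose 2 := by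
    rw [Nat.card_eq_fintype_card, Set.ncard_eq_toFinset_card']
    exact SimpleGraph.card_edgeFinset_le_card_choose_two
  rw [erWeight_eq, erWeight_eq, h1]
  obtain ⟨m, hm⟩ := Nat.exists_eq_add_of_le (h1 ▸ h2)
  have e1 : (Nat.card V).choose 2 - (Γ.edgeSet.ncard + 1) = m := by omega
  have e2 : (Nat.card V).choose 2 - Γ.edgeSet.ncard = m + 1 := by omega
  rw [e1, e2]
  ring

open Classical in
/-- Independence of one pair from the others: if `f` does not depend on whether `ab` is an edge,
then the event that it is one has conditional probability `p` given any information in `f`. -/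
theorem sum_erWeight_adj (p : unitInterval) {a b : V} (hab : a ≠ b) (f : SimpleGraph V → ℝ)
    (hf : ∀ Γ, f (Γ ⊔ SimpleGraph.edge a b) = f Γ) :
    ∑ Γ, erWeight p Γ * (if Γ.Adj a b then f Γ else 0) = p * ∑ Γ, erWeight p Γ * f Γ := by
  have h1 : (1 - p : ℝ) * ∑ Γ with Γ.Adj a b, erWeight p Γ * f Γ =
      p * ∑ Γ with ¬ Γ.Adj a b, erWeight p Γ * f Γ := by
    rw [Finset.mul_sum, Finset.mul_sum]
    symm
    refine Finset.sum_bij' (fun Γ _ => Γ ⊔ SimpleGraph.edge a b)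
      (fun Γ _ => Γ.deleteEdges {s(a, b)}) ?_ ?_ ?_ ?_ ?_
    · intro Γ _
      simp [SimpleGraph.edge_adj, hab]
    · intro Γ _
      simp [SimpleGraph.deleteEdges_adj]
    · intro Γ hΓ
      have hΓ' : ¬ Γ.Adj a b := by simpa using hΓ
      ext x y
      simp only [SimpleGraph.deleteEdges_adj, SimpleGraph.sup_adj, SimpleGraph.edge_adj,
        Set.mem_singleton_iff, Sym2.eq_iff]
      constructor
      · tauto
      · intro h
        refine ⟨Or.inl h, ?_⟩
        rintro (⟨rfl, rfl⟩ | ⟨rfl, rfl⟩)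
        · exact hΓ' h
        · exact hΓ' h.symm
    · intro Γ hΓ
      have hΓ' : Γ.Adj a b := by simpa using hΓ
      ext x y
      simp only [SimpleGraph.deleteEdges_adj, SimpleGraph.sup_adj, SimpleGraph.edge_adj,
        Set.mem_singleton_iff, Sym2.eq_iff]
      constructor
      · rintro (h | ⟨⟨rfl, rfl⟩ | ⟨rfl, rfl⟩, -⟩)
        · exact h.1
        · exact hΓ'
        · exact hΓ'.symm
      · intro h
        have := h.ne
        tauto
    · intro Γ hΓ
      have hΓ' : ¬ Γ.Adj a b := by simpa using hΓ
      rw [← mul_assoc, ← mul_assoc, erWeight_mul_sup_edge p hab hΓ', hf]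
  have h2 := Finset.sum_filter_add_sum_filter_not Finset.univ
    (fun Γ : SimpleGraph V => Γ.Adj a b) (fun Γ => erWeight p Γ * f Γ)
  simp only [mul_ite, mul_zero, ← Finset.sum_filter]
  rw [← h2]
  linarith

end Weights

/-! ### Components of a subcritical random graph -/

section Exploration

variable {V : Type}

/-- The vertices that can be reached in `Γ` from `A` along steps that all end in `U`. -/
def reachedFrom (Γ : SimpleGraph V) (A U : Finset V) : Set V :=
  {x | ∃ b ∈ A, Relation.ReflTransGen (fun y z => Γ.Adj y z ∧ z ∈ U) b x}

open Classical in
/-- The neighbours of `a` in `U`. -/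
noncomputable def nbrsIn (Γ : SimpleGraph V) (a : V) (U : Finset V) : Finset V :=
  U.filter fun u => Γ.Adj a u

theorem reachedFrom_empty (Γ : SimpleGraph V) (U : Finset V) : reachedFrom Γ ∅ U = ∅ := by
  simp [reachedFrom]

theorem nbrsIn_sup_edge {Γ : SimpleGraph V} {a x y : V} {U : Finset V}
    (h : ∀ u ∈ U, s(a, u) ≠ s(x, y)) :
    nbrsIn (Γ ⊔ SimpleGraph.edge x y) a U = nbrsIn Γ a U := by
  ext u
  simp only [nbrsIn, Finset.mem_filter, SimpleGraph.sup_adj, SimpleGraph.edge_adj,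
    and_congr_right_iff, or_iff_left_iff_imp]
  rintro hu ⟨h', -⟩
  exact absurd (by simpa [Sym2.eq_iff] using h') (h u hu)

variable [DecidableEq V]

/-- One exploration step: the active vertex `a` is finished, its unexplored neighbours become
active. -/
theorem reachedFrom_subset_insert (Γ : SimpleGraph V) (A U : Finset V) (a : V) :
    reachedFrom Γ A U ⊆
      insert a (reachedFrom Γ (A.erase a ∪ nbrsIn Γ a U) (U \ nbrsIn Γ a U)) := by
  rintro x ⟨b, hb, hx⟩
  induction hx with
  | refl =>
    by_cases h : b = a
    · exact Or.inl h
    · exact Or.inr ⟨b, by simp [h, hb], .refl⟩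
  | @tail y z _ hyz ih =>
    obtain ⟨hadj, hz⟩ := hyz
    by_cases hn : z ∈ nbrsIn Γ a U
    · exact Or.inr ⟨z, by simp [hn], .refl⟩
    · rcases ih with rfl | ⟨c, hc, hcy⟩
      · exact absurd (by simp [nbrsIn, hz, hadj]) hn
      · exact Or.inr ⟨c, hc, hcy.tail ⟨hadj, by simp [hz, hn]⟩⟩

variable {Ω : Type} [Fintype Ω]

open Classical in
/-- A random graph `G` on a finite weighted space `(Ω, W)` has edge density at most `q` if every
pair is an edge with probability at most `q` given any information on the other pairs; this
information is encoded as a nonnegative function that does not depend on the pair. -/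
def DensityLE (W : Ω → ℝ) (G : Ω → SimpleGraph V) (q : ℝ) : Prop :=
  ∀ a b : V, a ≠ b → ∀ f : SimpleGraph V → ℝ, (∀ Γ, 0 ≤ f Γ) →
    (∀ Γ, f (Γ ⊔ SimpleGraph.edge a b) = f Γ) →
    ∑ ω, W ω * (if (G ω).Adj a b then f (G ω) else 0) ≤ q * ∑ ω, W ω * f (G ω)

/-- The number of neighbours of `a` in `U` has a moment generating function at most that of a
binomial variable. -/
theorem sum_mul_pow_card_nbrsIn_le {W : Ω → ℝ} {G : Ω → SimpleGraph V} {q : ℝ}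
    (hG : DensityLE W G q) (hq : 0 ≤ q) {z : ℝ} (hz : 1 ≤ z) (a : V)
    (f : SimpleGraph V → ℝ) (hf : ∀ Γ, 0 ≤ f Γ) (U : Finset V) (ha : a ∉ U)
    (hfU : ∀ u ∈ U, ∀ Γ, f (Γ ⊔ SimpleGraph.edge a u) = f Γ) :
    ∑ ω, W ω * (f (G ω) * z ^ (nbrsIn (G ω) a U).card) ≤
      (1 + q * (z - 1)) ^ U.card * ∑ ω, W ω * f (G ω) := by
  classical
  induction U using Finset.induction_on with
  | empty => simp [nbrsIn]
  | insert u U hu ih =>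
    have hau : a ≠ u := by rintro rfl; simp at ha
    have ih' := ih (by simp at ha; tauto) (fun v hv => hfU v (by simp [hv]))
    set f' : SimpleGraph V → ℝ := fun Γ => f Γ * z ^ (nbrsIn Γ a U).card with hf'
    have hf'0 : ∀ Γ, 0 ≤ f' Γ := fun Γ => mul_nonneg (hf Γ) (by positivity)
    have hins : ∀ Γ, f' (Γ ⊔ SimpleGraph.edge a u) = f' Γ := by
      intro Γ
      rw [hf']
      dsimp only
      rw [hfU u (by simp), nbrsIn_sup_edge]
      intro v hv h
      have : v = u := by
        rcases Sym2.eq_iff.1 h with ⟨-, h⟩ | ⟨h, h'⟩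
        exacts [h, h'.trans h]
      exact hu (this ▸ hv)
    have hstep : ∀ Γ : SimpleGraph V, f Γ * z ^ (nbrsIn Γ a (insert u U)).card =
        f' Γ + (z - 1) * (if Γ.Adj a u then f' Γ else 0) := by
      intro Γ
      by_cases h : Γ.Adj a u
      · have : nbrsIn Γ a (insert u U) = insert u (nbrsIn Γ a U) := by
          simp [nbrsIn, Finset.filter_insert, h]
        rw [this, Finset.card_insert_of_notMem (by simp [nbrsIn, hu])]
        simp only [hf', h, if_true]
        ring
      · have : nbrsIn Γ a (insert u U) = nbrsIn Γ a U := by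
          simp [nbrsIn, Finset.filter_insert, h]
        rw [this]
        simp [hf', h]
    have hd := hG a u hau f' hf'0 hins
    have hsum : ∑ ω, W ω * (f (G ω) * z ^ (nbrsIn (G ω) a (insert u U)).card) =
        ∑ ω, W ω * f' (G ω) +
          (z - 1) * ∑ ω, W ω * (if (G ω).Adj a u then f' (G ω) else 0) := by
      rw [Finset.mul_sum, ← Finset.sum_add_distrib]
      refine Finset.sum_congr rfl fun ω _ => ?_
      rw [hstep]
      ring
    rw [hsum, Finset.card_insert_of_notMem hu, pow_succ]
    have hq1 : 0 ≤ 1 + q * (z - 1) := by nlinarith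
    calc _ ≤ ∑ ω, W ω * f' (G ω) + (z - 1) * (q * ∑ ω, W ω * f' (G ω)) := by
          gcongr
      _ = (1 + q * (z - 1)) * ∑ ω, W ω * f' (G ω) := by ring
      _ ≤ (1 + q * (z - 1)) * ((1 + q * (z - 1)) ^ U.card * ∑ ω, W ω * f (G ω)) := by
          gcongr
      _ = _ := by ring

variable [Fintype V]

/-- Exponential moment of the explored set, by comparison with a branching process: each of the
active vertices contributes a factor at most `z`, if `z` is a supersolution of the fixed point
equation of the total progeny. -/
theorem sum_mul_pow_ncard_reachedFrom_le {W : Ω → ℝ} {G : Ω → SimpleGraph V} {q : ℝ}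
    (hG : DensityLE W G q) (hW : ∀ ω, 0 ≤ W ω) (hq : 0 ≤ q) {z θ : ℝ} (hz : 1 ≤ z) (hθ : 1 ≤ θ)
    (hzθ : θ * (1 + q * (z - 1)) ^ Fintype.card V ≤ z) (m : ℕ) :
    ∀ (A U : Finset V) (f : SimpleGraph V → ℝ), Disjoint A U → A.card + U.card = m →
      (∀ Γ, 0 ≤ f Γ) →
      (∀ x ∈ A ∪ U, ∀ u ∈ U, x ≠ u → ∀ Γ, f (Γ ⊔ SimpleGraph.edge x u) = f Γ) →
      ∑ ω, W ω * (f (G ω) * θ ^ (reachedFrom (G ω) A U).ncard) ≤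
        z ^ A.card * ∑ ω, W ω * f (G ω) := by
  classical
  induction m with
  | zero =>
    intro A U f _ hm _ _
    have hA : A = ∅ := by rw [← Finset.card_eq_zero]; omega
    simp [hA, reachedFrom_empty]
  | succ m ih =>
    intro A U f hAU hm hf hins
    rcases A.eq_empty_or_nonempty with rfl | ⟨a, ha⟩
    · simp [reachedFrom_empty]
    have haU : a ∉ U := Finset.disjoint_left.1 hAU ha
    have hsplit : ∑ ω, W ω * (f (G ω) * θ ^ (reachedFrom (G ω) A U).ncard) ≤
        ∑ B ∈ U.powerset, θ * ∑ ω, W ω * ((if nbrsIn (G ω) a U = B then f (G ω) else 0) *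
          θ ^ (reachedFrom (G ω) (A.erase a ∪ B) (U \ B)).ncard) := by
      simp_rw [Finset.mul_sum]
      rw [Finset.sum_comm]
      refine Finset.sum_le_sum fun ω _ => ?_
      rw [Finset.sum_eq_single_of_mem (nbrsIn (G ω) a U)
        (Finset.mem_powerset.2 (Finset.filter_subset _ _))
        (fun B _ hB => by rw [if_neg hB.symm]; simp)]
      rw [if_pos rfl]
      have hc : (reachedFrom (G ω) A U).ncard ≤ (reachedFrom (G ω)
          (A.erase a ∪ nbrsIn (G ω) a U) (U \ nbrsIn (G ω) a U)).ncard + 1 :=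
        (Set.ncard_le_ncard (reachedFrom_subset_insert (G ω) A U a) (Set.toFinite _)).trans
          (Set.ncard_insert_le _ _)
      have hp := pow_le_pow_right₀ hθ hc
      calc _ ≤ W ω * (f (G ω) * θ ^ ((reachedFrom (G ω)
          (A.erase a ∪ nbrsIn (G ω) a U) (U \ nbrsIn (G ω) a U)).ncard + 1)) :=
            mul_le_mul_of_nonneg_left (mul_le_mul_of_nonneg_left hp (hf _)) (hW ω)
        _ = _ := by ring
    refine hsplit.trans ?_
    have hB : ∀ B ∈ U.powerset, θ * ∑ ω, W ω * ((if nbrsIn (G ω) a U = B then f (G ω) else 0) *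
          θ ^ (reachedFrom (G ω) (A.erase a ∪ B) (U \ B)).ncard) ≤
        θ * (z ^ (A.card - 1 + B.card) *
          ∑ ω, W ω * (if nbrsIn (G ω) a U = B then f (G ω) else 0)) := by
      intro B hB
      have hBU := Finset.mem_powerset.1 hB
      have hdis : Disjoint (A.erase a) B :=
        (hAU.mono_left (Finset.erase_subset _ _)).mono_right hBU
      have hcard : (A.erase a ∪ B).card = A.card - 1 + B.card := by
        rw [Finset.card_union_of_disjoint hdis, Finset.card_erase_of_mem ha]
      have hApos : 0 < A.card := Finset.card_pos.2 ⟨a, ha⟩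
      have hBc := Finset.card_le_card hBU
      rw [← hcard]
      refine mul_le_mul_of_nonneg_left ?_ (by linarith)
      refine ih (A.erase a ∪ B) (U \ B) (fun Γ => if nbrsIn Γ a U = B then f Γ else 0) ?_ ?_ ?_ ?_
      · rw [Finset.disjoint_union_left]
        exact ⟨(hAU.mono_left (Finset.erase_subset _ _)).mono_right Finset.sdiff_subset,
          Finset.disjoint_sdiff⟩
      · rw [hcard, Finset.card_sdiff_of_subset hBU]
        omega
      · intro Γ
        split_ifs
        exacts [hf Γ, le_rfl]
      · intro x hx u hu hxu Γ
        have hu' : u ∈ U := (Finset.mem_sdiff.1 hu).1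
        have hxa : x ≠ a := by
          rintro rfl
          simp only [Finset.mem_union, Finset.mem_sdiff, Finset.mem_erase] at hx
          have := @hBU x
          tauto
        have hua : u ≠ a := by rintro rfl; exact haU hu'
        have hx' : x ∈ A ∪ U := by
          simp only [Finset.mem_union, Finset.mem_sdiff, Finset.mem_erase] at hx ⊢
          have := @hBU x
          tauto
        rw [nbrsIn_sup_edge, hins x hx' u hu' hxu]
        intro v _ h
        simp only [Sym2.eq_iff] at h
        rcases h with ⟨h, _⟩ | ⟨h, _⟩
        · exact hxa h.symm
        · exact hua h.symm
    refine (Finset.sum_le_sum hB).trans ?_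
    have hmgf := sum_mul_pow_card_nbrsIn_le hG hq hz a f hf U haU
      (fun u hu => hins a (by simp [ha]) u hu (by rintro rfl; exact haU hu))
    have hsum0 : 0 ≤ ∑ ω, W ω * f (G ω) :=
      Finset.sum_nonneg fun ω _ => mul_nonneg (hW ω) (hf _)
    have hq1 : 1 ≤ 1 + q * (z - 1) := by nlinarith
    have hz0 : 0 ≤ z ^ (A.card - 1) := by positivity
    have heq : ∑ B ∈ U.powerset, θ * (z ^ (A.card - 1 + B.card) *
          ∑ ω, W ω * (if nbrsIn (G ω) a U = B then f (G ω) else 0)) =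
        θ * z ^ (A.card - 1) * ∑ ω, W ω * (f (G ω) * z ^ (nbrsIn (G ω) a U).card) := by
      simp_rw [Finset.mul_sum]
      rw [Finset.sum_comm]
      refine Finset.sum_congr rfl fun ω _ => ?_
      rw [Finset.sum_eq_single_of_mem (nbrsIn (G ω) a U)
        (Finset.mem_powerset.2 (Finset.filter_subset _ _))
        (fun B _ hB => by rw [if_neg hB.symm]; simp)]
      rw [if_pos rfl, pow_add]
      ring
    rw [heq]
    calc _ ≤ θ * z ^ (A.card - 1) *
          ((1 + q * (z - 1)) ^ U.card * ∑ ω, W ω * f (G ω)) := by gcongr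
      _ ≤ θ * z ^ (A.card - 1) *
          ((1 + q * (z - 1)) ^ Fintype.card V * ∑ ω, W ω * f (G ω)) := by
          gcongr
          exact Finset.card_le_univ U
      _ = z ^ (A.card - 1) * (θ * (1 + q * (z - 1)) ^ Fintype.card V) *
          ∑ ω, W ω * f (G ω) := by ring
      _ ≤ z ^ (A.card - 1) * z * ∑ ω, W ω * f (G ω) := by gcongr
      _ = _ := by
          rw [← pow_succ, Nat.sub_add_cancel (Finset.card_pos.2 ⟨a, ha⟩)]

/-- Exponential moment of the size of a connected component. -/
theorem sum_mul_pow_ncard_supp_le {W : Ω → ℝ} {G : Ω → SimpleGraph V} {q : ℝ}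
    (hG : DensityLE W G q) (hW : ∀ ω, 0 ≤ W ω) (hW1 : ∑ ω, W ω = 1) (hq : 0 ≤ q) {z θ : ℝ}
    (hz : 1 ≤ z) (hθ : 1 ≤ θ) (hzθ : θ * (1 + q * (z - 1)) ^ Fintype.card V ≤ z) (v : V) :
    ∑ ω, W ω * θ ^ ((G ω).connectedComponentMk v).supp.ncard ≤ z := by
  have h := sum_mul_pow_ncard_reachedFrom_le hG hW hq hz hθ hzθ _ {v} (Finset.univ.erase v)
    (fun _ => 1) (by simp) rfl (by simp) (by simp)
  simp only [one_mul, mul_one, hW1, Finset.card_singleton, pow_one] at h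
  refine le_trans (Finset.sum_le_sum fun ω _ => ?_) h
  refine mul_le_mul_of_nonneg_left (pow_le_pow_right₀ hθ ?_) (hW ω)
  refine Set.ncard_le_ncard ?_ (Set.toFinite _)
  intro x hx
  have hr : (G ω).Reachable v x := by
    rw [SimpleGraph.ConnectedComponent.mem_supp_iff, SimpleGraph.ConnectedComponent.eq] at hx
    exact hx.symm
  rw [SimpleGraph.reachable_iff_reflTransGen] at hr
  induction hr with
  | refl => exact ⟨v, by simp, .refl⟩
  | @tail y w _ hyw ih =>
    by_cases hwv : w = v
    · exact ⟨v, by simp, hwv ▸ .refl⟩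
    · obtain ⟨b, hb, hby⟩ := ih (SimpleGraph.ConnectedComponent.sound
        ((SimpleGraph.reachable_iff_reflTransGen _ _).2 ‹_›).symm)
      exact ⟨b, hb, hby.tail ⟨hyw, by simp [hwv]⟩⟩

end Exploration

/-! ### The pair of graphs and the information revealed by queries -/

section Pairs

variable {V : Type}

/-- The probability of a single sample point `(Gstar, H)`. -/
noncomputable def pairWeight (p η : unitInterval) (ω : SimpleGraph V × SimpleGraph V) : ℝ :=
  erWeight p ω.1 * erWeight η ω.2

theorem pairWeight_nonneg (p η : unitInterval) (ω : SimpleGraph V × SimpleGraph V) :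
    0 ≤ pairWeight p η ω :=
  mul_nonneg (erWeight_nonneg _ _) (erWeight_nonneg _ _)

theorem apply_sup_edge_inf {f : SimpleGraph V → ℝ} {a b : V}
    (hf : ∀ Γ, f (Γ ⊔ SimpleGraph.edge a b) = f Γ) (T H : SimpleGraph V) :
    f ((T ⊔ SimpleGraph.edge a b) ⊓ H) = f (T ⊓ H) := by
  by_cases h : H.Adj a b
  · have : SimpleGraph.edge a b ≤ H := by
      rw [SimpleGraph.edge_le_iff]
      exact Or.inr h
    rw [inf_sup_right, inf_eq_left.2 this, hf]
  · have : SimpleGraph.edge a b ⊓ H = ⊥ := by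
      ext x y
      simp only [SimpleGraph.inf_adj, SimpleGraph.edge_adj, SimpleGraph.bot_adj, iff_false]
      rintro ⟨⟨⟨rfl, rfl⟩ | ⟨rfl, rfl⟩, -⟩, h'⟩
      exacts [h h', h h'.symm]
    rw [inf_sup_right, this, sup_bot_eq]

variable [Fintype V] [DecidableEq V]

theorem sum_pairWeight (p η : unitInterval) :
    ∑ ω : SimpleGraph V × SimpleGraph V, pairWeight p η ω = 1 := by
  simp only [pairWeight, Fintype.sum_prod_type]
  simp_rw [← Finset.mul_sum, sum_erWeight, mul_one]
  exact sum_erWeight p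

/-- The prior graph has edge density at most `p * η`. -/
theorem densityLE_prior (p η : unitInterval) :
    DensityLE (pairWeight p η) (fun ω : SimpleGraph V × SimpleGraph V => ω.1 ⊓ ω.2)
      ((p : ℝ) * η) := by
  classical
  intro a b hab f _ hins
  refine le_of_eq ?_
  simp only [pairWeight, Fintype.sum_prod_type]
  calc _ = ∑ H : SimpleGraph V, erWeight η H * (if H.Adj a b then
          ∑ T, erWeight p T * (if T.Adj a b then f (T ⊓ H) else 0) else 0) := by
        rw [Finset.sum_comm]
        refine Finset.sum_congr rfl fun H _ => ?_
        by_cases h : H.Adj a b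
        · simp only [h, SimpleGraph.inf_adj, and_true, if_true, Finset.mul_sum]
          exact Finset.sum_congr rfl fun T _ => by ring
        · simp [h]
    _ = ∑ H : SimpleGraph V, erWeight η H * (if H.Adj a b then
          p * ∑ T, erWeight p T * f (T ⊓ H) else 0) := by
        refine Finset.sum_congr rfl fun H _ => ?_
        rw [sum_erWeight_adj p hab (fun T => f (T ⊓ H))
          (fun T => apply_sup_edge_inf hins T H)]
    _ = η * ∑ H : SimpleGraph V, erWeight η H * (p * ∑ T, erWeight p T * f (T ⊓ H)) := by
        rw [← sum_erWeight_adj η hab (fun H => p * ∑ T, erWeight p T * f (T ⊓ H))]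
        intro H
        simp only [inf_comm _ (H ⊔ _), inf_comm _ H]
        simp_rw [apply_sup_edge_inf hins H]
    _ = _ := by
        rw [Finset.sum_comm]
        simp only [Finset.mul_sum]
        refine Finset.sum_congr rfl fun H _ => Finset.sum_congr rfl fun T _ => ?_
        ring

open Classical in
theorem sum_pairWeight_reachable_eq (p η : unitInterval) {s t t' : V} (ht : s ≠ t)
    (ht' : s ≠ t') :
    ∑ ω : SimpleGraph V × SimpleGraph V,
        pairWeight p η ω * (if (ω.1 ⊓ ω.2).Reachable s t then 1 else 0) =
      ∑ ω : SimpleGraph V × SimpleGraph V,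
        pairWeight p η ω * (if (ω.1 ⊓ ω.2).Reachable s t' then 1 else 0) := by
  set σ : Equiv.Perm V := Equiv.swap t t' with hσ
  have hinv : ∀ Γ : SimpleGraph V, (Γ.comap σ).comap σ = Γ := by
    intro Γ
    ext x y
    simp [hσ]
  refine Finset.sum_bij' (fun ω _ => (ω.1.comap σ, ω.2.comap σ))
    (fun ω _ => (ω.1.comap σ, ω.2.comap σ)) (by simp) (by simp) (by simp [hinv]) (by simp [hinv])
    fun ω _ => ?_
  have h1 : pairWeight p η (ω.1.comap σ, ω.2.comap σ) = pairWeight p η ω := by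
    simp only [pairWeight, erWeight_comap_equiv]
  have h2 : (ω.1.comap σ ⊓ ω.2.comap σ).Reachable s t' ↔ (ω.1 ⊓ ω.2).Reachable s t := by
    have h := (SimpleGraph.Iso.comap σ (ω.1 ⊓ ω.2)).reachable_iff (u := s) (v := t')
    have e1 : (SimpleGraph.Iso.comap σ (ω.1 ⊓ ω.2)) s = s := by
      change σ s = s
      exact Equiv.swap_apply_of_ne_of_ne ht ht'
    have e2 : (SimpleGraph.Iso.comap σ (ω.1 ⊓ ω.2)) t' = t := by
      change σ t' = t
      simp [hσ]
    rw [e1, e2] at h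
    rw [h]
    rfl
  rw [h1]
  simp only [h2]

open Classical in
/-- By exchangeability of the vertices, the probability that the prior graph connects two given
vertices is governed by the mean size of a component. -/
theorem sum_pairWeight_reachable_le (p η : unitInterval) {s t : V} (hst : s ≠ t) :
    ((Fintype.card V : ℝ) - 1) * ∑ ω : SimpleGraph V × SimpleGraph V,
        pairWeight p η ω * (if (ω.1 ⊓ ω.2).Reachable s t then 1 else 0) ≤
      ∑ ω : SimpleGraph V × SimpleGraph V,
        pairWeight p η ω * (((ω.1 ⊓ ω.2).connectedComponentMk s).supp.ncard : ℝ) := by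
  have hc : ((Fintype.card V : ℝ) - 1) = ∑ t' ∈ Finset.univ.erase s, (1 : ℝ) := by
    rw [Finset.sum_const, Finset.card_erase_of_mem (Finset.mem_univ s), Finset.card_univ,
      nsmul_eq_mul, mul_one, Nat.cast_sub (Fintype.card_pos_iff.2 ⟨s⟩), Nat.cast_one]
  rw [hc, Finset.sum_mul]
  calc _ = ∑ t' ∈ Finset.univ.erase s, ∑ ω : SimpleGraph V × SimpleGraph V,
        pairWeight p η ω * (if (ω.1 ⊓ ω.2).Reachable s t' then 1 else 0) := by
        refine Finset.sum_congr rfl fun t' ht' => ?_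
        rw [one_mul, sum_pairWeight_reachable_eq p η hst (Finset.ne_of_mem_erase ht').symm]
    _ ≤ _ := by
        rw [Finset.sum_comm]
        refine Finset.sum_le_sum fun ω _ => ?_
        rw [← Finset.mul_sum]
        refine mul_le_mul_of_nonneg_left ?_ (pairWeight_nonneg _ _ _)
        rw [← Finset.sum_filter, Finset.sum_const, nsmul_eq_mul, mul_one, Nat.cast_le,
          ← Set.ncard_coe_finset]
        refine Set.ncard_le_ncard ?_ (Set.toFinite _)
        intro x hx
        have hx' : (ω.1 ⊓ ω.2).Reachable s x := by
          simp only [Finset.coe_filter, Set.mem_ofPred_eq] at hx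
          exact hx.2
        exact SimpleGraph.ConnectedComponent.sound hx'.symm

/-- The part of `T` that consists of the edges with an end in `Q`. -/
def revealed (Q : Set V) (T : SimpleGraph V) : SimpleGraph V where
  Adj x y := T.Adj x y ∧ (x ∈ Q ∨ y ∈ Q)
  symm := ⟨fun _ _ h => ⟨h.1.symm, h.2.symm⟩⟩
  loopless := ⟨fun x h => T.loopless.irrefl x h.1⟩

/-- The sample points with prior graph `G` whose ground truth has exactly the edges of `Γ` at
the vertices of `Q`: the information available after the vertices of `Q` have been explored. -/
def infoEvent (G : SimpleGraph V) (Q : Set V) (Γ : SimpleGraph V) :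
    Set (SimpleGraph V × SimpleGraph V) :=
  {ω | ω.1 ⊓ ω.2 = G ∧ revealed Q ω.1 = Γ}

open Classical in
/-- A pair outside `Q` that is not an edge of the prior graph is an edge of the ground truth with
conditional probability at most `p`, given the prior graph and the edges at `Q`. The conditional
probability is `p` if the pair is not in the mask, and zero if it is. -/
theorem sum_infoEvent_adj_le (p η : unitInterval) (G : SimpleGraph V) (Q : Set V)
    (Γ : SimpleGraph V) {x y : V} (hxy : x ≠ y) (hx : x ∉ Q) (hy : y ∉ Q) (hG : ¬ G.Adj x y) :
    ∑ ω, pairWeight p η ω * (if ω ∈ infoEvent G Q Γ ∧ ω.1.Adj x y then 1 else 0) ≤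
      p * ∑ ω, pairWeight p η ω * (if ω ∈ infoEvent G Q Γ then 1 else 0) := by
  simp only [pairWeight, Fintype.sum_prod_type_right]
  rw [Finset.mul_sum]
  refine Finset.sum_le_sum fun H _ => ?_
  have hfac : ∀ (P : SimpleGraph V → Prop) [DecidablePred P],
      ∑ T, erWeight p T * erWeight η H * (if P T then 1 else 0) =
        erWeight η H * ∑ T, erWeight p T * (if P T then 1 else 0) := by
    intro P _
    rw [Finset.mul_sum]
    exact Finset.sum_congr rfl fun T _ => by ring
  rw [hfac fun T => (T, H) ∈ infoEvent G Q Γ ∧ T.Adj x y, hfac fun T => (T, H) ∈ infoEvent G Q Γ,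
    mul_left_comm]
  refine mul_le_mul_of_nonneg_left ?_ (erWeight_nonneg _ _)
  by_cases h : H.Adj x y
  · refine le_trans (le_of_eq (Finset.sum_eq_zero fun T _ => ?_)) (mul_nonneg p.2.1
      (Finset.sum_nonneg fun T _ => mul_nonneg (erWeight_nonneg _ _) (by split_ifs <;> simp)))
    rw [if_neg, mul_zero]
    rintro ⟨⟨h1, -⟩, h2⟩
    exact hG (h1 ▸ ⟨h2, h⟩)
  · rw [← sum_erWeight_adj p hxy]
    · refine le_of_eq (Finset.sum_congr rfl fun T _ => ?_)
      by_cases hT : T.Adj x y <;> simp [hT]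
    · intro T
      have e1 : (T ⊔ SimpleGraph.edge x y) ⊓ H = T ⊓ H := by
        ext a b
        simp only [SimpleGraph.inf_adj, SimpleGraph.sup_adj, SimpleGraph.edge_adj]
        constructor
        · rintro ⟨h1 | ⟨⟨rfl, rfl⟩ | ⟨rfl, rfl⟩, -⟩, h2⟩
          exacts [⟨h1, h2⟩, absurd h2 h, absurd h2.symm h]
        · tauto
      have e2 : revealed Q (T ⊔ SimpleGraph.edge x y) = revealed Q T := by
        ext a b
        simp only [revealed, SimpleGraph.sup_adj, SimpleGraph.edge_adj]
        constructor
        · rintro ⟨h1 | ⟨⟨rfl, rfl⟩ | ⟨rfl, rfl⟩, -⟩, h2⟩ <;> tauto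
        · tauto
      have e3 : (T ⊔ SimpleGraph.edge x y, H) ∈ infoEvent G Q Γ ↔ (T, H) ∈ infoEvent G Q Γ := by
        simp only [infoEvent, Set.mem_ofPred_eq, e1, e2]
      simp only [e3]

end Pairs

/-! ### Adaptive strategies -/

section Connectivity

variable {V : Type}

theorem not_reachable_of_closed {H : SimpleGraph V} {Z : Set V} {s t : V} (hs : s ∈ Z)
    (ht : t ∉ Z) (hZ : ∀ x ∈ Z, ∀ y, H.Adj x y → y ∈ Z) : ¬ H.Reachable s t := by
  rintro ⟨w⟩
  obtain ⟨d, -, h1, h2⟩ := w.exists_boundary_dart Z hs ht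
  exact h2 (hZ _ h1 _ d.adj)

/-- Let `Y` be a set of vertices that contains `s`, `t` and all vertices seen so far, and let `C`
be the component that is queried. If the query reveals no edge from `C` to a vertex of `Y`
outside `C`, then it does not connect `s` with `t`: all new edges lead from `C` to fresh
components. -/
theorem not_reachable_sup_of_no_new_edge {G Γ Γ' : SimpleGraph V} {C Y : Set V} {s t : V}
    (hs : s ∈ Y) (ht : t ∈ Y) (hYG : ∀ x ∈ Y, ∀ y, G.Adj x y → y ∈ Y)
    (hYΓ : ∀ x y, Γ.Adj x y → x ∈ Y) (hn : ¬ (G ⊔ Γ).Reachable s t)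
    (hC : ∀ x ∈ C, ∀ y ∈ C, G.Reachable x y)
    (hΓ' : ∀ x y, Γ'.Adj x y → Γ.Adj x y ∨ x ∈ C ∨ y ∈ C)
    (hnew : ∀ x ∈ C, ∀ y ∈ Y, y ∉ C → Γ'.Adj x y → Γ.Adj x y) :
    ¬ (G ⊔ Γ').Reachable s t := by
  set Z : Set V := {x | (G ⊔ Γ).Reachable s x} with hZ
  have hsZ : s ∈ Z := SimpleGraph.Reachable.refl s
  have hadj : ∀ x ∈ Z, ∀ y, (G ⊔ Γ).Adj x y → y ∈ Z := fun x hx y h =>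
    SimpleGraph.Reachable.trans hx h.reachable
  have hZY : Z ⊆ Y := by
    intro x hx
    by_contra hxY
    refine not_reachable_of_closed (H := G ⊔ Γ) hs hxY ?_ hx
    rintro a ha b (h | h)
    · exact hYG a ha b h
    · exact hYΓ b a h.symm
  by_cases hCZ : ∃ c ∈ C, c ∈ Z
  · obtain ⟨c, hc, hcZ⟩ := hCZ
    have hCZ : C ⊆ Z := fun x hx =>
      SimpleGraph.Reachable.trans hcZ ((hC c hc x hx).mono le_sup_left)
    -- the fresh vertices may become connected to `s`, but to nothing else that was seen before
    refine not_reachable_of_closed (Z := Z ∪ Yᶜ) (Or.inl hsZ) ?_ ?_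
    · rintro (h | h)
      exacts [hn h, h ht]
    · intro x hx y hxy
      by_contra hy
      simp only [Set.mem_union, Set.mem_compl_iff, not_or, not_not] at hy
      obtain ⟨hyZ, hyY⟩ := hy
      have hyC : y ∉ C := fun h => hyZ (hCZ h)
      have hxC : x ∈ C → Γ'.Adj x y → False := fun h h' =>
        hyZ (hadj x (hCZ h) y (Or.inr (hnew x h y hyY hyC h')))
      rcases hx with hx | hx
      · rcases hxy with h | h
        · exact hyZ (hadj x hx y (Or.inl h))
        · rcases hΓ' x y h with h' | h' | h'
          · exact hyZ (hadj x hx y (Or.inr h'))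
          · exact hxC h' h
          · exact hyC h'
      · rcases hxy with h | h
        · exact hx (hYG y hyY x h.symm)
        · rcases hΓ' x y h with h' | h' | h'
          · exact hx (hYΓ x y h')
          · exact hxC h' h
          · exact hyC h'
  · push Not at hCZ
    refine not_reachable_of_closed (Z := Z) hsZ hn ?_
    rintro x hx y (h | h)
    · exact hadj x hx y (Or.inl h)
    · rcases hΓ' x y h with h' | h' | h'
      · exact hadj x hx y (Or.inr h')
      · exact absurd hx (hCZ x h')
      · have hxC : x ∉ C := fun h => hCZ x h hx
        exact hadj x hx y (Or.inr (hnew y h' x (hZY hx) hxC h.symm).symm)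

/-- If the observed graph `H` does not connect `s` with `t`, then every path from `s` to `t` has
an edge that is not observed, and this edge can be read off the list of vertices. -/
theorem exists_unobserved_edge {H : SimpleGraph V} {s t : V} (hn : ¬ H.Reachable s t)
    {T₀ : SimpleGraph V} {l : List V} (h₀ : IsPathList T₀ s t l) :
    ∃ x y, ¬ H.Adj x y ∧ ∀ T : SimpleGraph V, IsPathList T s t l → T.Adj x y := by
  obtain ⟨P, -, rfl⟩ := h₀
  obtain ⟨d, hd, h1, h2⟩ := P.exists_boundary_dart {x | H.Reachable s x}
    (SimpleGraph.Reachable.refl s) hn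
  refine ⟨d.fst, d.snd, fun h => h2 (SimpleGraph.Reachable.trans h1 h.reachable), ?_⟩
  have hsup : ∃ l₁ l₂, P.support = l₁ ++ d.fst :: d.snd :: l₂ := by
    clear h1 h2 hn
    induction P with
    | nil => simp at hd
    | @cons u v w h q ih =>
      rw [SimpleGraph.Walk.darts_cons, List.mem_cons] at hd
      rcases hd with rfl | hd
      · exact ⟨[], q.support.tail, by
          rw [SimpleGraph.Walk.support_cons, List.nil_append]
          exact congrArg _ q.cons_tail_support.symm⟩
      · obtain ⟨l₁, l₂, h'⟩ := ih hd
        exact ⟨u :: l₁, l₂, by rw [SimpleGraph.Walk.support_cons, h', List.cons_append]⟩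
  rintro T ⟨P', -, h'⟩
  have hch := P'.isChain_adj_support
  obtain ⟨l₁, l₂, hl⟩ := hsup
  rw [h', hl, List.isChain_append_cons_cons] at hch
  exact hch.2.1

theorem revealed_revealed {Q Q' : Set V} (h : Q ⊆ Q') (T : SimpleGraph V) :
    revealed Q (revealed Q' T) = revealed Q T := by
  ext x y
  simp only [revealed]
  have hx := @h x
  have hy := @h y
  tauto

theorem cciOracle_revealed {G : SimpleGraph V} {Q : Set V} {v : V}
    (hQ : (G.connectedComponentMk v).supp ⊆ Q) (T : SimpleGraph V) :
    cciOracle (revealed Q T) G v = cciOracle T G v := by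
  have : cciEdges (revealed Q T) G v = cciEdges T G v := by
    ext e
    simp only [cciEdges, Set.mem_ofPred_eq, revealed]
    have := @hQ e.1
    tauto
  rw [cciOracle, cciOracle, this]

open Classical in
/-- The number of pairs in `D` that are edges of `T`. -/
noncomputable def edgeCount (D : Finset (V × V)) (T : SimpleGraph V) : ℕ :=
  (D.filter fun e => T.Adj e.1 e.2).card

theorem edgeCount_revealed {D : Finset (V × V)} {Q : Set V} (h : ∀ e ∈ D, e.1 ∈ Q)
    (T : SimpleGraph V) : edgeCount D (revealed Q T) = edgeCount D T := by
  classical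
  unfold edgeCount
  congr 1
  refine Finset.filter_congr fun e he => ?_
  simp [revealed, h e he]

/-- The vertices that count as seen after the component `C` has been queried, if those of `Y`
counted as seen before and the pairs in `D` are new: the endpoints of new edges come with their
components. -/
def seenAfter (G T : SimpleGraph V) (C Y : Set V) (D : Finset (V × V)) : Set V :=
  Y ∪ C ∪ {w | ∃ e ∈ D, T.Adj e.1 e.2 ∧ G.Reachable e.2 w}

theorem ncard_seenAfter_le [Fintype V] {G : SimpleGraph V} {L : ℝ}
    (hL : ∀ v, ((G.connectedComponentMk v).supp.ncard : ℝ) ≤ L) (T : SimpleGraph V) (v : V)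
    (Y : Set V) (D : Finset (V × V)) :
    ((seenAfter G T (G.connectedComponentMk v).supp Y D).ncard : ℝ) ≤
      Y.ncard + L + L * edgeCount D T := by
  classical
  have h1 : seenAfter G T (G.connectedComponentMk v).supp Y D ⊆
      Y ∪ (G.connectedComponentMk v).supp ∪
        ⋃ e ∈ D.filter fun e => T.Adj e.1 e.2, (G.connectedComponentMk e.2).supp := by
    rintro w (h | ⟨e, he, hT, hr⟩)
    · exact Or.inl h
    · refine Or.inr (Set.mem_biUnion (x := e) (by simpa using ⟨he, hT⟩) ?_)
      exact SimpleGraph.ConnectedComponent.sound hr.symm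
  have h2 : (⋃ e ∈ D.filter fun e => T.Adj e.1 e.2, (G.connectedComponentMk e.2).supp).ncard ≤
      ∑ e ∈ D.filter fun e => T.Adj e.1 e.2, (G.connectedComponentMk e.2).supp.ncard :=
    Finset.set_ncard_biUnion_le _ _
  have h3 : ((∑ e ∈ D.filter fun e => T.Adj e.1 e.2,
      (G.connectedComponentMk e.2).supp.ncard : ℕ) : ℝ) ≤ L * edgeCount D T := by
    rw [Nat.cast_sum]
    refine (Finset.sum_le_sum fun e _ => hL e.2).trans (le_of_eq ?_)
    rw [Finset.sum_const, nsmul_eq_mul, mul_comm, edgeCount]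
  have h4 := Set.ncard_le_ncard h1 (Set.toFinite _)
  have h5 := Set.ncard_union_le (Y ∪ (G.connectedComponentMk v).supp)
    (⋃ e ∈ D.filter fun e => T.Adj e.1 e.2, (G.connectedComponentMk e.2).supp)
  have h6 := Set.ncard_union_le Y (G.connectedComponentMk v).supp
  have h7 : ((seenAfter G T (G.connectedComponentMk v).supp Y D).ncard : ℝ) ≤
      Y.ncard + (G.connectedComponentMk v).supp.ncard + ((∑ e ∈ D.filter fun e => T.Adj e.1 e.2,
        (G.connectedComponentMk e.2).supp.ncard : ℕ) : ℝ) := by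
    exact_mod_cast h4.trans (h5.trans (add_le_add h6 h2))
  linarith [hL v]

end Connectivity

section Induction

variable {V : Type} [Fintype V] [DecidableEq V]

open Classical in
/-- The probability of an event for the pair of graphs. -/
noncomputable def pairProb (p η : unitInterval) (S : Set (SimpleGraph V × SimpleGraph V)) : ℝ :=
  ∑ ω, pairWeight p η ω * (if ω ∈ S then 1 else 0)

theorem pairProb_nonneg (p η : unitInterval) (S : Set (SimpleGraph V × SimpleGraph V)) :
    0 ≤ pairProb p η S :=
  Finset.sum_nonneg fun ω _ => mul_nonneg (pairWeight_nonneg _ _ _) (by split_ifs <;> simp)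

theorem pairProb_mono (p η : unitInterval) {S S' : Set (SimpleGraph V × SimpleGraph V)}
    (h : S ⊆ S') : pairProb p η S ≤ pairProb p η S' := by
  refine Finset.sum_le_sum fun ω _ => mul_le_mul_of_nonneg_left ?_ (pairWeight_nonneg _ _ _)
  by_cases h1 : ω ∈ S
  · simp [h1, h h1]
  · rw [if_neg h1]
    split_ifs <;> simp

@[simp] theorem pairProb_empty (p η : unitInterval) :
    pairProb p η (∅ : Set (SimpleGraph V × SimpleGraph V)) = 0 := by
  simp [pairProb]

theorem pairProb_infoEvent_adj_le (p η : unitInterval) (G : SimpleGraph V) (Q : Set V)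
    (Γ : SimpleGraph V) {x y : V} (hxy : x ≠ y) (hx : x ∉ Q) (hy : y ∉ Q) (hG : ¬ G.Adj x y) :
    pairProb p η {ω | ω ∈ infoEvent G Q Γ ∧ ω.1.Adj x y} ≤
      p * pairProb p η (infoEvent G Q Γ) := by
  classical
  refine le_trans (le_of_eq ?_) (sum_infoEvent_adj_le p η G Q Γ hxy hx hy hG)
  refine Finset.sum_congr rfl fun ω _ => ?_
  simp only [Set.mem_ofPred_eq]
  congr

/-- Summation over the values of an auxiliary variable `r`. -/
theorem sum_mul_pairProb_fiber (p η : unitInterval) (S : Set (SimpleGraph V × SimpleGraph V))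
    {ι : Type} [Fintype ι] (r : SimpleGraph V × SimpleGraph V → ι) (g : ι → ℝ) :
    ∑ i, g i * pairProb p η (S ∩ {ω | r ω = i}) =
      ∑ ω, pairWeight p η ω * (S.indicator (fun ω => g (r ω)) ω) := by
  classical
  simp only [pairProb, Finset.mul_sum]
  rw [Finset.sum_comm]
  refine Finset.sum_congr rfl fun ω _ => ?_
  rw [Finset.sum_eq_single_of_mem (r ω) (Finset.mem_univ _)]
  · by_cases h : ω ∈ S <;> simp [h, mul_comm]
  · intro i _ hi
    rw [if_neg fun h => hi h.2.symm]
    simp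

theorem sum_pairProb_fiber (p η : unitInterval) (S : Set (SimpleGraph V × SimpleGraph V))
    {ι : Type} [Fintype ι] (r : SimpleGraph V × SimpleGraph V → ι) :
    ∑ i, pairProb p η (S ∩ {ω | r ω = i}) = pairProb p η S := by
  classical
  have := sum_mul_pairProb_fiber p η S r (fun _ => 1)
  simp only [one_mul] at this
  rw [this]
  simp [pairProb, Set.indicator_apply]

/-- Among the unexplored pairs in `D`, a proportion of at most `p` is present in expectation. -/
theorem sum_indicator_edgeCount_le (p η : unitInterval) (G : SimpleGraph V) (Q : Set V)
    (Γ : SimpleGraph V) (D : Finset (V × V))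
    (hD : ∀ e ∈ D, e.1 ≠ e.2 ∧ e.1 ∉ Q ∧ e.2 ∉ Q ∧ ¬ G.Adj e.1 e.2) :
    ∑ ω, pairWeight p η ω * ((infoEvent G Q Γ).indicator (fun ω => (edgeCount D ω.1 : ℝ)) ω) ≤
      p * D.card * pairProb p η (infoEvent G Q Γ) := by
  classical
  have h : ∀ ω : SimpleGraph V × SimpleGraph V,
      (infoEvent G Q Γ).indicator (fun ω => (edgeCount D ω.1 : ℝ)) ω =
        ∑ e ∈ D, if ω ∈ infoEvent G Q Γ ∧ ω.1.Adj e.1 e.2 then 1 else 0 := by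
    intro ω
    by_cases hω : ω ∈ infoEvent G Q Γ
    · rw [Set.indicator_of_mem hω, edgeCount, Finset.card_filter]
      simp [hω]
    · simp [hω]
  simp_rw [h, Finset.mul_sum]
  rw [Finset.sum_comm]
  have : (p : ℝ) * D.card * pairProb p η (infoEvent G Q Γ) =
      ∑ e ∈ D, (p : ℝ) * pairProb p η (infoEvent G Q Γ) := by
    rw [Finset.sum_const, nsmul_eq_mul]
    ring
  rw [this]
  refine Finset.sum_le_sum fun e he => ?_
  obtain ⟨h1, h2, h3, h4⟩ := hD e he
  refine le_trans (le_of_eq ?_) (pairProb_infoEvent_adj_le p η G Q Γ h1 h2 h3 h4)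
  refine Finset.sum_congr rfl fun ω _ => ?_
  simp only [Set.mem_ofPred_eq]
  congr

/-- The event that a strategy which knows the prior graph `G` succeeds with at most `k`
queries. -/
def successWithin (G : SimpleGraph V) (s t : V) (k : ℕ) (σ : Strategy V) :
    Set (SimpleGraph V × SimpleGraph V) :=
  {ω | IsPathList ω.1 s t (σ.run (cciOracle ω.1 G)) ∧ σ.numQueries (cciOracle ω.1 G) ≤ k}

/-- A strategy that stops before it has observed a connection has to guess an edge. -/
theorem pairProb_successWithin_output_le (p η : unitInterval) {G : SimpleGraph V} {Q : Set V}
    {Γ : SimpleGraph V} {s t : V} (hn : ¬ (G ⊔ Γ).Reachable s t) (k : ℕ) (l : List V) :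
    pairProb p η (infoEvent G Q Γ ∩ successWithin G s t k (.output l)) ≤
      p * pairProb p η (infoEvent G Q Γ) := by
  rcases (infoEvent G Q Γ ∩ successWithin G s t k (.output l)).eq_empty_or_nonempty with h | h
  · rw [h, pairProb_empty]
    exact mul_nonneg p.2.1 (pairProb_nonneg _ _ _)
  · obtain ⟨ω₀, ⟨-, hΓ₀⟩, h₀, -⟩ := h
    obtain ⟨x, y, hxy, hall⟩ := exists_unobserved_edge hn h₀
    have hT := hall ω₀.1 h₀
    have hQ : ¬ (x ∈ Q ∨ y ∈ Q) := by
      intro h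
      refine hxy (Or.inr ?_)
      rw [← hΓ₀]
      exact ⟨hT, h⟩
    push Not at hQ
    refine le_trans (pairProb_mono p η (S' := {ω | ω ∈ infoEvent G Q Γ ∧ ω.1.Adj x y}) ?_)
      (pairProb_infoEvent_adj_le p η G Q Γ hT.ne hQ.1 hQ.2 fun h => hxy (Or.inl h))
    rintro ω ⟨h1, h2, -⟩
    exact ⟨h1, hall ω.1 h2⟩

/-- The state of an exploration in which `s` and `t` are not yet connected: `Y` is a set of seen
vertices that contains `s`, `t` and the ends of all observed edges and is a union of components of
`G`. -/
structure Unconnected (G Γ : SimpleGraph V) (s t : V) (Y : Set V) : Prop where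
  left_mem : s ∈ Y
  right_mem : t ∈ Y
  closed : ∀ x ∈ Y, ∀ y, G.Adj x y → y ∈ Y
  mem_of_adj : ∀ x y, Γ.Adj x y → x ∈ Y
  not_reachable : ¬ (G ⊔ Γ).Reachable s t

/-- A query keeps `s` and `t` unconnected unless it reveals an edge between the queried component
and a seen vertex outside. -/
theorem Unconnected.query {G Γ T : SimpleGraph V} {s t : V} {Y Q : Set V}
    (h : Unconnected G Γ s t Y) (hΓ : revealed Q T = Γ) (v : V) {D : Finset (V × V)}
    (hD : ∀ e, e ∈ D ↔ e.1 ∈ (G.connectedComponentMk v).supp ∧ e.1 ∉ Q ∧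
      e.2 ∉ (G.connectedComponentMk v).supp ∧ e.2 ∉ Q)
    (hno : ∀ e ∈ D, e.2 ∈ Y → ¬ T.Adj e.1 e.2) :
    Unconnected G (revealed (Q ∪ (G.connectedComponentMk v).supp) T) s t
      (seenAfter G T (G.connectedComponentMk v).supp Y D) where
  left_mem := Or.inl (Or.inl h.left_mem)
  right_mem := Or.inl (Or.inl h.right_mem)
  closed := by
    rintro x ((hx | hx) | ⟨e, he, hT, hr⟩) y hxy
    · exact Or.inl (Or.inl (h.closed x hx y hxy))
    · refine Or.inl (Or.inr ?_)
      exact (SimpleGraph.ConnectedComponent.sound hxy.symm.reachable).trans hx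
    · exact Or.inr ⟨e, he, hT, hr.trans hxy.reachable⟩
  mem_of_adj := by
    rintro x y ⟨hT, hQ⟩
    by_cases hQ' : x ∈ Q ∨ y ∈ Q
    · exact Or.inl (Or.inl (h.mem_of_adj x y (hΓ ▸ ⟨hT, hQ'⟩)))
    · push Not at hQ'
      by_cases hx : x ∈ (G.connectedComponentMk v).supp
      · exact Or.inl (Or.inr hx)
      · have hy : y ∈ (G.connectedComponentMk v).supp := by
          simp only [Set.mem_union] at hQ
          tauto
        exact Or.inr ⟨(y, x), (hD _).2 ⟨hy, hQ'.2, hx, hQ'.1⟩, hT.symm, .refl x⟩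
  not_reachable := by
    refine not_reachable_sup_of_no_new_edge (C := (G.connectedComponentMk v).supp) h.left_mem
      h.right_mem h.closed h.mem_of_adj h.not_reachable ?_ ?_ ?_
    · intro x hx y hy
      exact SimpleGraph.ConnectedComponent.exact (Eq.trans hx (Eq.symm hy))
    · rintro x y ⟨hT, hQ⟩
      subst hΓ
      simp only [revealed, Set.mem_union] at hQ ⊢
      tauto
    · rintro x hx y hy hyC ⟨hT, -⟩
      subst hΓ
      refine ⟨hT, ?_⟩
      by_contra hQ
      push Not at hQ
      exact hno (x, y) ((hD _).2 ⟨hx, hQ.1, hyC, hQ.2⟩) hy hT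

/-- The success probability of a strategy with at most `k` queries, given the information gathered
so far, on a prior graph whose components have at most `L` vertices. The term `p` comes from
guessing the last edge. A query connects `s` with `t` with probability at most `p * L * |Y|`, and
it increases the number `|Y|` of seen vertices by at most `L + L * (L * n * p)` in expectation. -/
theorem pairProb_successWithin_le (p η : unitInterval) {G : SimpleGraph V} {s t : V} {L : ℝ}
    (hL : ∀ v, ((G.connectedComponentMk v).supp.ncard : ℝ) ≤ L) (hL0 : 0 ≤ L)
    (σ : Strategy V) :
    ∀ (k : ℕ) (Q : Set V) (Γ : SimpleGraph V) (Y : Set V), Unconnected G Γ s t Y →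
      pairProb p η (infoEvent G Q Γ ∩ successWithin G s t k σ) ≤
        (p + k * (p * L * Y.ncard) +
          k ^ 2 * (p * L * (L + L * (L * Fintype.card V * p)))) *
          pairProb p η (infoEvent G Q Γ) := by
  classical
  have hp0 : (0 : ℝ) ≤ p := p.2.1
  induction σ with
  | output l =>
    intro k Q Γ Y hU
    refine (pairProb_successWithin_output_le p η hU.not_reachable k l).trans ?_
    refine mul_le_mul_of_nonneg_right ?_ (pairProb_nonneg _ _ _)
    have h1 : (0 : ℝ) ≤ k * (p * L * Y.ncard) := by positivity
    have h2 : (0 : ℝ) ≤ k ^ 2 * (p * L * (L + L * (L * Fintype.card V * p))) := by positivity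
    linarith
  | query v next ih =>
    intro k Q Γ Y hU
    cases k with
    | zero =>
      have : infoEvent G Q Γ ∩ successWithin G s t 0 (.query v next) = ∅ := by
        ext ω
        simp [successWithin, Strategy.numQueries]
      rw [this, pairProb_empty]
      have := pairProb_nonneg p η (infoEvent G Q Γ)
      positivity
    | succ k =>
    set C : Set V := (G.connectedComponentMk v).supp with hC
    set D : Finset (V × V) := (Finset.univ.filter fun x => x ∈ C ∧ x ∉ Q) ×ˢ
      (Finset.univ.filter fun y => y ∉ C ∧ y ∉ Q) with hDdef
    have hD : ∀ e, e ∈ D ↔ e.1 ∈ C ∧ e.1 ∉ Q ∧ e.2 ∉ C ∧ e.2 ∉ Q := by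
      intro e
      simp [hDdef, and_assoc]
    set DY : Finset (V × V) := D.filter fun e => e.2 ∈ Y with hDY
    have hCL : ((Finset.univ.filter fun x => x ∈ C ∧ x ∉ Q).card : ℝ) ≤ L := by
      refine le_trans ?_ (hL v)
      rw [Nat.cast_le, ← Set.ncard_coe_finset]
      exact Set.ncard_le_ncard (fun x hx => by simp at hx; exact hx.1) (Set.toFinite _)
    have hDcard : (D.card : ℝ) ≤ L * Fintype.card V := by
      rw [hDdef, Finset.card_product, Nat.cast_mul]
      gcongr
      exact Finset.card_le_univ _
    have hDYcard : (DY.card : ℝ) ≤ L * Y.ncard := by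
      have : DY ⊆ (Finset.univ.filter fun x => x ∈ C ∧ x ∉ Q) ×ˢ
          (Finset.univ.filter fun y => y ∈ Y) := by
        intro e he
        simp only [hDY, hDdef, Finset.mem_filter, Finset.mem_product, Finset.mem_univ,
          true_and] at he ⊢
        exact ⟨he.1.1, he.2⟩
      refine le_trans (Nat.cast_le.2 (Finset.card_le_card this)) ?_
      rw [Finset.card_product, Nat.cast_mul]
      gcongr
      rw [← Set.ncard_coe_finset]
      simp
    have hDprop : ∀ e ∈ D, e.1 ≠ e.2 ∧ e.1 ∉ Q ∧ e.2 ∉ Q ∧ ¬ G.Adj e.1 e.2 := by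
      intro e he
      obtain ⟨h1, h2, h3, h4⟩ := (hD e).1 he
      refine ⟨fun h => h3 (h ▸ h1), h2, h4, fun h => h3 ?_⟩
      exact (SimpleGraph.ConnectedComponent.sound h.symm.reachable).trans h1
    set Q' : Set V := Q ∪ C with hQ'
    have hCD : ∀ e ∈ D, e.1 ∈ Q' := fun e he => Or.inr ((hD e).1 he).1
    have hCDY : ∀ e ∈ DY, e.1 ∈ Q' := fun e he => hCD e (Finset.mem_filter.1 he).1
    set a : ℝ := L + L * (L * Fintype.card V * p) with ha
    have ha0 : 0 ≤ a := by positivity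
    -- the bound for the remaining queries after the edges of `Γ'` have been revealed
    set g : SimpleGraph V → ℝ := fun Γ' => edgeCount DY Γ' + (p +
      k * (p * L * (Y.ncard + L + L * edgeCount D Γ')) + k ^ 2 * (p * L * a)) with hg
    have hfiber : ∀ Γ', pairProb p η (infoEvent G Q Γ ∩ successWithin G s t (k + 1)
        (.query v next) ∩ {ω | revealed Q' ω.1 = Γ'}) ≤
        g Γ' * pairProb p η (infoEvent G Q Γ ∩ {ω | revealed Q' ω.1 = Γ'}) := by
      intro Γ'
      rcases (infoEvent G Q Γ ∩ {ω | revealed Q' ω.1 = Γ'}).eq_empty_or_nonempty with he | hne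
      · have : infoEvent G Q Γ ∩ successWithin G s t (k + 1)
            (.query v next) ∩ {ω | revealed Q' ω.1 = Γ'} = ∅ := by
          rw [Set.inter_right_comm, he, Set.empty_inter]
        rw [this, he]
        simp
      obtain ⟨ω₀, ⟨-, hω₀⟩, hω₀'⟩ := hne
      simp only [Set.mem_ofPred_eq] at hω₀'
      have hΓΓ' : revealed Q Γ' = Γ := by
        rw [← hω₀', revealed_revealed Set.subset_union_left, hω₀]
      have hinter : infoEvent G Q Γ ∩ {ω | revealed Q' ω.1 = Γ'} = infoEvent G Q' Γ' := by
        ext ω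
        simp only [infoEvent, Set.mem_inter_iff, Set.mem_ofPred_eq]
        constructor
        · rintro ⟨⟨h1, -⟩, h2⟩
          exact ⟨h1, h2⟩
        · rintro ⟨h1, h2⟩
          refine ⟨⟨h1, ?_⟩, h2⟩
          rw [← hΓΓ', ← h2, revealed_revealed Set.subset_union_left]
      have hsucc : infoEvent G Q Γ ∩ successWithin G s t (k + 1)
            (.query v next) ∩ {ω | revealed Q' ω.1 = Γ'} ⊆
          infoEvent G Q' Γ' ∩ successWithin G s t k (next (cciOracle Γ' G v)) := by
        rintro ω ⟨⟨h1, h2⟩, h3⟩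
        refine ⟨hinter ▸ ⟨h1, h3⟩, ?_⟩
        simp only [Set.mem_ofPred_eq] at h3
        have horacle : cciOracle Γ' G v = cciOracle ω.1 G v := by
          rw [← h3]
          exact cciOracle_revealed Set.subset_union_right ω.1
        simpa [successWithin, Strategy.run, Strategy.numQueries, horacle] using h2
      refine (pairProb_mono p η hsucc).trans ?_
      rw [hinter]
      have hrest : 0 ≤ (p : ℝ) + k * (p * L * (Y.ncard + L + L * edgeCount D Γ')) +
          k ^ 2 * (p * L * a) := by positivity
      by_cases hbad : 1 ≤ edgeCount DY Γ'
      · refine (pairProb_mono p η Set.inter_subset_left).trans ?_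
        refine le_mul_of_one_le_left (pairProb_nonneg _ _ _) ?_
        have : (1 : ℝ) ≤ edgeCount DY Γ' := by exact_mod_cast hbad
        simp only [hg]
        linarith
      · have hno : ∀ e ∈ D, e.2 ∈ Y → ¬ ω₀.1.Adj e.1 e.2 := by
          intro e he heY hadj
          refine hbad ?_
          rw [← hω₀', edgeCount_revealed hCDY]
          exact Finset.card_pos.2 ⟨e, by simp [hDY, he, heY, hadj]⟩
        have hU' := hU.query hω₀ v hD hno
        rw [hω₀'] at hU'
        refine (ih _ k Q' Γ' _ hU').trans ?_
        refine mul_le_mul_of_nonneg_right ?_ (pairProb_nonneg _ _ _)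
        have hY' := ncard_seenAfter_le hL ω₀.1 v Y D
        rw [← edgeCount_revealed hCD, hω₀'] at hY'
        have h0 : (0 : ℝ) ≤ edgeCount DY Γ' := Nat.cast_nonneg _
        have h1 : (k : ℝ) * (p * L * (seenAfter G ω₀.1 C Y D).ncard) ≤
            k * (p * L * (Y.ncard + L + L * edgeCount D Γ')) := by gcongr
        simp only [hg]
        linarith
    rw [← sum_pairProb_fiber p η _ fun ω => revealed Q' ω.1]
    refine (Finset.sum_le_sum fun Γ' _ => hfiber Γ').trans ?_
    rw [sum_mul_pairProb_fiber p η _ (fun ω => revealed Q' ω.1) g]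
    set I := infoEvent G Q Γ with hI
    have hexp : ∀ ω : SimpleGraph V × SimpleGraph V,
        pairWeight p η ω * I.indicator (fun ω => g (revealed Q' ω.1)) ω =
        pairWeight p η ω * I.indicator (fun ω => (edgeCount DY ω.1 : ℝ)) ω +
        (p + k * (p * L * (Y.ncard + L)) + k ^ 2 * (p * L * a)) *
          (pairWeight p η ω * if ω ∈ I then 1 else 0) +
        k * (p * L * L) *
          (pairWeight p η ω * I.indicator (fun ω => (edgeCount D ω.1 : ℝ)) ω) := by
      intro ω
      by_cases hω : ω ∈ I
      · simp only [Set.indicator_of_mem hω, if_pos hω, hg, edgeCount_revealed hCD,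
          edgeCount_revealed hCDY]
        ring
      · simp [hω]
    simp_rw [hexp]
    rw [Finset.sum_add_distrib, Finset.sum_add_distrib, ← Finset.mul_sum, ← Finset.mul_sum]
    have hb1 := sum_indicator_edgeCount_le p η G Q Γ DY
      (fun e he => hDprop e (Finset.mem_filter.1 he).1)
    have hb2 := sum_indicator_edgeCount_le p η G Q Γ D hDprop
    have hP := pairProb_nonneg p η I
    have hPdef : ∑ ω, pairWeight p η ω * (if ω ∈ I then 1 else 0) = pairProb p η I := rfl
    rw [hPdef]
    have hc1 : (p : ℝ) * DY.card * pairProb p η I ≤ p * (L * Y.ncard) * pairProb p η I := by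
      gcongr
    have hc2 : (p : ℝ) * D.card * pairProb p η I ≤
        p * (L * Fintype.card V) * pairProb p η I := by
      gcongr
    have hb3 := mul_le_mul_of_nonneg_left (hb2.trans hc2)
      (show 0 ≤ (k : ℝ) * (p * L * L) by positivity)
    have hslack : 0 ≤ ((k : ℝ) + 1) * (p * L * a) * pairProb p η I := by positivity
    calc _ ≤ p * (L * Y.ncard) * pairProb p η I +
          (p + k * (p * L * (Y.ncard + L)) + k ^ 2 * (p * L * a)) * pairProb p η I +
          k * (p * L * L) * (p * (L * Fintype.card V) * pairProb p η I) := by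
            linarith [hb1.trans hc1]
      _ = (p + (k + 1) * (p * L * Y.ncard) + (k + 1) ^ 2 * (p * L * a)) * pairProb p η I -
          (k + 1) * (p * L * a) * pairProb p η I := by
            rw [ha]
            ring
      _ ≤ _ := by
            push_cast
            linarith

end Induction

/-! ### From strategies to algorithms -/

section Deterministic

variable {V : Type} [Fintype V] [DecidableEq V]

theorem pairProb_union_le (p η : unitInterval) (S S' : Set (SimpleGraph V × SimpleGraph V)) :
    pairProb p η (S ∪ S') ≤ pairProb p η S + pairProb p η S' := by
  classical
  simp only [pairProb]
  rw [← Finset.sum_add_distrib]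
  refine Finset.sum_le_sum fun ω _ => ?_
  rw [← mul_add]
  refine mul_le_mul_of_nonneg_left ?_ (pairWeight_nonneg _ _ _)
  by_cases h1 : ω ∈ S <;> by_cases h2 : ω ∈ S' <;> simp [h1, h2]

theorem pairProb_univ (p η : unitInterval) :
    pairProb p η (Set.univ : Set (SimpleGraph V × SimpleGraph V)) = 1 := by
  simp [pairProb, sum_pairWeight]

/-- The event that the prior graph has a component with more than `L` vertices. -/
def largeComponent (V : Type) (L : ℝ) : Set (SimpleGraph V × SimpleGraph V) :=
  {ω | ∃ v, L < (((ω.1 ⊓ ω.2).connectedComponentMk v).supp.ncard : ℝ)}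

theorem pairProb_markov (p η : unitInterval) (X : SimpleGraph V × SimpleGraph V → ℝ)
    (hX : ∀ ω, 0 ≤ X ω) {c : ℝ} (S : Set (SimpleGraph V × SimpleGraph V))
    (hS : ∀ ω ∈ S, c ≤ X ω) :
    c * pairProb p η S ≤ ∑ ω, pairWeight p η ω * X ω := by
  classical
  rw [pairProb, Finset.mul_sum]
  refine Finset.sum_le_sum fun ω _ => ?_
  rw [mul_left_comm]
  refine mul_le_mul_of_nonneg_left ?_ (pairWeight_nonneg _ _ _)
  by_cases h : ω ∈ S
  · simpa [h] using hS ω h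
  · simpa [h] using hX ω

theorem pairProb_largeComponent_le (p η : unitInterval) {z θ : ℝ} (hz : 1 ≤ z) (hθ : 1 < θ)
    (hzθ : θ * (1 + (p : ℝ) * η * (z - 1)) ^ Fintype.card V ≤ z) {N L : ℝ}
    (hL : N ≤ Real.exp (L * Real.log θ)) :
    N * pairProb p η (largeComponent V L) ≤ Fintype.card V * z := by
  classical
  have hX : ∀ ω ∈ largeComponent V L,
      N ≤ ∑ v, θ ^ ((ω.1 ⊓ ω.2).connectedComponentMk v).supp.ncard := by
    rintro ω ⟨v, hv⟩
    have h1 : N ≤ θ ^ ((ω.1 ⊓ ω.2).connectedComponentMk v).supp.ncard := by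
      refine hL.trans ?_
      rw [← Real.exp_log (show 0 < θ by linarith), ← Real.exp_nat_mul, Real.log_exp]
      gcongr
      exact (Real.log_pos hθ).le
    exact h1.trans (Finset.single_le_sum
      (f := fun v => θ ^ ((ω.1 ⊓ ω.2).connectedComponentMk v).supp.ncard)
      (fun _ _ => by positivity) (Finset.mem_univ v))
  refine (pairProb_markov p η _ (fun ω => Finset.sum_nonneg fun v _ => by positivity) _
    hX).trans ?_
  simp_rw [Finset.mul_sum]
  rw [Finset.sum_comm]
  refine (Finset.sum_le_sum fun v _ => sum_mul_pow_ncard_supp_le (densityLE_prior p η)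
    (pairWeight_nonneg p η) (sum_pairWeight p η) (mul_nonneg p.2.1 η.2.1) hz hθ.le hzθ
    v).trans ?_
  simp

theorem pairProb_reachable_le (p η : unitInterval) {z θ : ℝ} (hz : 1 ≤ z) (hθ : 1 < θ)
    (hzθ : θ * (1 + (p : ℝ) * η * (z - 1)) ^ Fintype.card V ≤ z) {s t : V} (hst : s ≠ t) :
    ((Fintype.card V : ℝ) - 1) *
      pairProb p η {ω : SimpleGraph V × SimpleGraph V | (ω.1 ⊓ ω.2).Reachable s t} ≤
        z / (θ - 1) := by
  classical
  refine le_trans (le_of_eq ?_) ((sum_pairWeight_reachable_le p η hst).trans ?_)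
  · congr 1
    refine Finset.sum_congr rfl fun ω _ => ?_
    simp only [Set.mem_ofPred_eq]
    congr
  rw [le_div_iff₀ (by linarith), Finset.sum_mul]
  refine le_trans (Finset.sum_le_sum fun ω _ => ?_) (sum_mul_pow_ncard_supp_le
    (densityLE_prior p η) (pairWeight_nonneg p η) (sum_pairWeight p η)
    (mul_nonneg p.2.1 η.2.1) hz hθ.le hzθ s)
  rw [mul_assoc]
  refine mul_le_mul_of_nonneg_left ?_ (pairWeight_nonneg _ _ _)
  have := one_add_mul_le_pow (a := θ - 1) (by linarith)
    (((ω.1 ⊓ ω.2).connectedComponentMk s).supp.ncard)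
  rw [add_sub_cancel] at this
  linarith

/-- The success probability with at most `k` queries, for a strategy that may depend on the prior
graph. -/
theorem pairProb_success_le (p η : unitInterval) {s t : V} {L : ℝ} (hL0 : 0 ≤ L)
    (a : SimpleGraph V → Strategy V) (k : ℕ) :
    pairProb p η {ω | IsPathList ω.1 s t
        ((a (ω.1 ⊓ ω.2)).run (cciOracle ω.1 (ω.1 ⊓ ω.2)))} ≤
      pairProb p η {ω | k + 1 ≤ (a (ω.1 ⊓ ω.2)).numQueries (cciOracle ω.1 (ω.1 ⊓ ω.2))} +
        (pairProb p η (largeComponent V L) +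
          pairProb p η {ω : SimpleGraph V × SimpleGraph V | (ω.1 ⊓ ω.2).Reachable s t} +
          (p + k * (p * L * (2 * L)) +
            k ^ 2 * (p * L * (L + L * (L * Fintype.card V * p))))) := by
  classical
  set S₁ : Set (SimpleGraph V × SimpleGraph V) :=
    {ω | k + 1 ≤ (a (ω.1 ⊓ ω.2)).numQueries (cciOracle ω.1 (ω.1 ⊓ ω.2))}
  set S₂ := largeComponent V L with hS₂
  set S₃ := {ω : SimpleGraph V × SimpleGraph V | (ω.1 ⊓ ω.2).Reachable s t} with hS₃
  set c : ℝ := p + k * (p * L * (2 * L)) +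
    k ^ 2 * (p * L * (L + L * (L * Fintype.card V * p))) with hc
  have hp0 : (0 : ℝ) ≤ p := p.2.1
  have hc0 : 0 ≤ c := by positivity
  set S₄ : Set (SimpleGraph V × SimpleGraph V) :=
    {ω | ω ∈ successWithin (ω.1 ⊓ ω.2) s t k (a (ω.1 ⊓ ω.2)) ∧ ω ∉ S₂ ∧ ω ∉ S₃} with hS₄
  have hsub : {ω | IsPathList ω.1 s t ((a (ω.1 ⊓ ω.2)).run (cciOracle ω.1 (ω.1 ⊓ ω.2)))} ⊆
      S₁ ∪ ((S₂ ∪ S₃) ∪ S₄) := by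
    intro ω hω
    by_cases h1 : ω ∈ S₁
    · exact Or.inl h1
    by_cases h2 : ω ∈ S₂
    · exact Or.inr (Or.inl (Or.inl h2))
    by_cases h3 : ω ∈ S₃
    · exact Or.inr (Or.inl (Or.inr h3))
    · exact Or.inr (Or.inr ⟨⟨hω, by
        have : ¬ (k + 1 ≤ _) := h1
        omega⟩, h2, h3⟩)
  have h4 : pairProb p η S₄ ≤ c := by
    rw [← sum_pairProb_fiber p η S₄ fun ω => ω.1 ⊓ ω.2]
    have hfib : ∀ G : SimpleGraph V, pairProb p η (S₄ ∩ {ω | ω.1 ⊓ ω.2 = G}) ≤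
        c * pairProb p η (Set.univ ∩ {ω | ω.1 ⊓ ω.2 = G}) := by
      intro G
      have hinfo : infoEvent G ∅ ⊥ = Set.univ ∩ {ω | ω.1 ⊓ ω.2 = G} := by
        have : ∀ T : SimpleGraph V, revealed ∅ T = ⊥ := by
          intro T
          ext x y
          simp [revealed]
        ext ω
        simp [infoEvent, this]
      rcases (S₄ ∩ {ω | ω.1 ⊓ ω.2 = G}).eq_empty_or_nonempty with he | ⟨ω₀, ⟨_, h2, h3⟩, h0⟩
      · rw [he, pairProb_empty]
        exact mul_nonneg hc0 (pairProb_nonneg _ _ _)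
      replace h2 : ∀ v, ((G.connectedComponentMk v).supp.ncard : ℝ) ≤ L := by
        subst h0
        simpa [hS₂, largeComponent] using h2
      replace h3 : ¬ G.Reachable s t := by
        subst h0
        exact h3
      have hU : Unconnected G ⊥ s t
          ((G.connectedComponentMk s).supp ∪ (G.connectedComponentMk t).supp) :=
        { left_mem := Or.inl rfl
          right_mem := Or.inr rfl
          closed := by
            rintro x (hx | hx) y hxy
            · exact Or.inl ((SimpleGraph.ConnectedComponent.sound hxy.symm.reachable).trans hx)
            · exact Or.inr ((SimpleGraph.ConnectedComponent.sound hxy.symm.reachable).trans hx)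
          mem_of_adj := by simp
          not_reachable := by simpa using h3 }
      have hY : (((G.connectedComponentMk s).supp ∪
          (G.connectedComponentMk t).supp).ncard : ℝ) ≤ 2 * L := by
        have h := Set.ncard_union_le (G.connectedComponentMk s).supp
          (G.connectedComponentMk t).supp
        have h' : (((G.connectedComponentMk s).supp ∪
          (G.connectedComponentMk t).supp).ncard : ℝ) ≤
            (G.connectedComponentMk s).supp.ncard + (G.connectedComponentMk t).supp.ncard := by
          exact_mod_cast h
        linarith [h2 s, h2 t]
      have hmain := pairProb_successWithin_le p η h2 hL0 (a G) k ∅ ⊥ _ hU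
      rw [← hinfo]
      refine (pairProb_mono p η ?_).trans (hmain.trans ?_)
      · rintro ω ⟨⟨h, -, -⟩, hG⟩
        have hG' : ω.1 ⊓ ω.2 = G := hG
        rw [hG'] at h
        exact ⟨hinfo ▸ ⟨trivial, hG⟩, h⟩
      · refine mul_le_mul_of_nonneg_right ?_ (pairProb_nonneg _ _ _)
        rw [hc]
        gcongr
    refine (Finset.sum_le_sum fun G _ => hfib G).trans (le_of_eq ?_)
    rw [← Finset.mul_sum, sum_pairProb_fiber p η Set.univ fun ω => ω.1 ⊓ ω.2, pairProb_univ,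
      mul_one]
  refine (pairProb_mono p η hsub).trans ((pairProb_union_le p η _ _).trans ?_)
  gcongr
  refine (pairProb_union_le p η _ _).trans ?_
  gcongr
  exact pairProb_union_le p η _ _

end Deterministic

section Law

variable {n : ℕ}

theorem graphLaw_real_eq (p η : unitInterval)
    (S : Set (SimpleGraph (Fin n) × SimpleGraph (Fin n))) :
    (graphLaw n p η).real S = pairProb p η S := by
  classical
  have := discreteMeasurableSpace_simpleGraph (V := Fin n)
  have : IsProbabilityMeasure (graphLaw n p η) := by unfold graphLaw; infer_instance
  have h := sum_measureReal_singleton (μ := graphLaw n p η) S.toFinset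
  rw [Set.coe_toFinset] at h
  rw [← h, pairProb]
  simp only [mul_ite, mul_one, mul_zero]
  rw [← Finset.sum_filter]
  refine Finset.sum_congr (by ext; simp) fun ω _ => ?_
  rw [pairWeight, erWeight, erWeight, graphLaw, ← measureReal_prod_prod,
    Set.singleton_prod_singleton]

theorem graphLaw_eq (p η : unitInterval)
    (S : Set (SimpleGraph (Fin n) × SimpleGraph (Fin n))) :
    graphLaw n p η S = ENNReal.ofReal (pairProb p η S) := by
  have : IsProbabilityMeasure (graphLaw n p η) := by unfold graphLaw; infer_instance
  rw [← graphLaw_real_eq, ofReal_measureReal]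

theorem successProb_le_one (p η : unitInterval) (s t : Fin n) (A : RandomizedAlgorithm n) :
    successProb p η s t A ≤ 1 := by
  have : IsProbabilityMeasure (graphLaw n p η) := by unfold graphLaw; infer_instance
  rw [← A.tsum_coe, successProb]
  exact ENNReal.tsum_le_tsum fun a => mul_le_of_le_one_right' prob_le_one

/-- Averaging over the randomness of the algorithm, with Markov's inequality for the number of
queries. -/
theorem successProb_le (p η : unitInterval) {s t : Fin n} {L : ℝ} (hL0 : 0 ≤ L)
    (A : RandomizedAlgorithm n) (k : ℕ) :
    successProb p η s t A ≤ expectedQueries p η A / (k + 1) +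
      ENNReal.ofReal (pairProb p η (largeComponent (Fin n) L) +
        pairProb p η {ω : SimpleGraph (Fin n) × SimpleGraph (Fin n) |
          (ω.1 ⊓ ω.2).Reachable s t} +
        (p + k * (p * L * (2 * L)) + k ^ 2 * (p * L * (L + L * (L * n * p))))) := by
  have := discreteMeasurableSpace_simpleGraph (V := Fin n)
  set R : ℝ := pairProb p η (largeComponent (Fin n) L) +
        pairProb p η {ω : SimpleGraph (Fin n) × SimpleGraph (Fin n) |
          (ω.1 ⊓ ω.2).Reachable s t} +
        (p + k * (p * L * (2 * L)) + k ^ 2 * (p * L * (L + L * (L * n * p)))) with hR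
  have hdet : ∀ a : Algorithm n, graphLaw n p η
      {ω | IsPathList (truth ω) s t ((a (prior ω)).run (cciOracle (truth ω) (prior ω)))} ≤
      (∫⁻ ω, ((a (prior ω)).numQueries (cciOracle (truth ω) (prior ω)) : ℝ≥0∞)
        ∂(graphLaw n p η)) / (k + 1) + ENNReal.ofReal R := by
    intro a
    have h1 := pairProb_success_le p η (s := s) (t := t) hL0 a k
    rw [Fintype.card_fin, ← hR] at h1
    have h2 := ENNReal.ofReal_le_ofReal h1
    have h3 := h2.trans ENNReal.ofReal_add_le
    rw [← graphLaw_eq, ← graphLaw_eq] at h3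
    refine h3.trans (add_le_add_left ?_ _)
    rw [ENNReal.le_div_iff_mul_le (Or.inl (by simp)) (Or.inl (by finiteness)), mul_comm]
    refine le_trans (mul_le_mul_right ?_ _) (mul_meas_ge_le_lintegral (μ := graphLaw n p η)
      (f := fun ω => ((a (prior ω)).numQueries (cciOracle (truth ω) (prior ω)) : ℝ≥0∞))
      Measurable.of_discrete ((k : ℝ≥0∞) + 1))
    refine measure_mono fun ω hω => ?_
    have hω' : k + 1 ≤ (a (prior ω)).numQueries (cciOracle (truth ω) (prior ω)) := hω
    exact_mod_cast hω'
  calc successProb p η s t A ≤ ∑' a, A a * ((∫⁻ ω, ((a (prior ω)).numQueries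
          (cciOracle (truth ω) (prior ω)) : ℝ≥0∞) ∂(graphLaw n p η)) / (k + 1) +
            ENNReal.ofReal R) :=
        ENNReal.tsum_le_tsum fun a => mul_le_mul_right (hdet a) _
    _ = _ := by
        simp_rw [mul_add, ← mul_div_assoc, div_eq_mul_inv]
        rw [ENNReal.tsum_add, ENNReal.tsum_mul_right, ENNReal.tsum_mul_right, A.tsum_coe, one_mul,
          expectedQueries]

end Law

/-! ### Asymptotic estimates -/

section Numerics

/-- With `M = (log n) ^ (1 / 4)` times the critical number of queries and components of size
`K * log n`, the probability of observing a connection is of order `1 / M`. -/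
theorem connection_bound {n p K M k : ℝ} (hK : 0 ≤ K) (hn : 0 < n)
    (hlog : 1 ≤ Real.log n) (hp : 1.5 * Real.log n / n ≤ p) (hM : 1 ≤ M)
    (hM4 : M ^ 4 = Real.log n) (hk0 : 0 ≤ k)
    (hk : k ≤ M * (1 / (p * Real.log n ^ 2 * Real.sqrt n))) :
    k * (p * (K * Real.log n) * (2 * (K * Real.log n))) + k ^ 2 * (p * (K * Real.log n) *
        (K * Real.log n + K * Real.log n * (K * Real.log n * n * p))) ≤
      (3 * K ^ 2 + K ^ 3) / M := by
  set l := Real.log n with hl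
  have hp0 : 0 < p := lt_of_lt_of_le (by positivity) hp
  have hr0 : 0 < Real.sqrt n := Real.sqrt_pos.2 hn
  have hr2 : Real.sqrt n ^ 2 = n := Real.sq_sqrt hn.le
  set r := Real.sqrt n with hr
  have hln : l ≤ n := (Real.log_le_sub_one_of_pos hn).trans (by linarith)
  have hM2r : M ^ 2 ≤ r := by
    have : (M ^ 2) ^ 2 ≤ r ^ 2 := by rw [hr2, show (M ^ 2) ^ 2 = M ^ 4 by ring]; linarith
    exact le_of_sq_le_sq this hr0.le
  have hkp : k * p * (l ^ 2 * r) ≤ M := by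
    have : k * (p * l ^ 2 * r) ≤ M := by
      rw [mul_one_div, le_div_iff₀ (by positivity)] at hk
      exact hk
    linarith
  have hpn : l ≤ p * n := by
    rw [div_le_iff₀ hn] at hp
    linarith
  -- the contribution of edges between a queried component and the components of `s` and `t`
  have h1 : k * (p * (K * l) * (2 * (K * l))) ≤ 2 * K ^ 2 / M := by
    rw [le_div_iff₀ (by linarith)]
    have : k * p * l ^ 2 * M ≤ 1 := by
      have h : k * p * l ^ 2 * M ^ 2 ≤ M := by
        calc k * p * l ^ 2 * M ^ 2 ≤ k * p * l ^ 2 * r := by gcongr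
          _ ≤ M := by linarith
      have hM0 : 0 < M := by linarith
      by_contra hcon
      push Not at hcon
      nlinarith
    calc k * (p * (K * l) * (2 * (K * l))) * M = 2 * K ^ 2 * (k * p * l ^ 2 * M) := by ring
      _ ≤ 2 * K ^ 2 * 1 := by gcongr
      _ = _ := by ring
  have hsq : (k * p) ^ 2 * (l ^ 4 * n) ≤ M ^ 2 := by
    have h := pow_le_pow_left₀ (by positivity) hkp 2
    calc (k * p) ^ 2 * (l ^ 4 * n) = (k * p * (l ^ 2 * r)) ^ 2 := by rw [← hr2]; ring
      _ ≤ _ := h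
  have hX : (k * p) ^ 2 * (l ^ 3 * n) * M ^ 2 ≤ 1 := by
    have h : (k * p) ^ 2 * (l ^ 3 * n) * M ^ 2 * M ^ 2 ≤ M ^ 2 := by
      calc (k * p) ^ 2 * (l ^ 3 * n) * M ^ 2 * M ^ 2
          = (k * p) ^ 2 * (l ^ 3 * n) * M ^ 4 := by ring
        _ = (k * p) ^ 2 * (l ^ 4 * n) := by rw [hM4]; ring
        _ ≤ _ := hsq
    have hM0 : 0 < M ^ 2 := by positivity
    by_contra hcon
    push Not at hcon
    nlinarith
  have hXM : (k * p) ^ 2 * (l ^ 3 * n) * M ≤ 1 := by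
    refine le_trans ?_ hX
    refine mul_le_mul_of_nonneg_left ?_ (by positivity)
    nlinarith
  have h2 : k ^ 2 * (p * (K * l) * (K * l + K * l * (K * l * n * p))) ≤
      (K ^ 2 + K ^ 3) / M := by
    rw [le_div_iff₀ (by linarith)]
    have hA : k ^ 2 * p * l ^ 2 ≤ (k * p) ^ 2 * (l ^ 3 * n) := by
      calc k ^ 2 * p * l ^ 2 ≤ k ^ 2 * p * l ^ 2 * (l * (p * n)) :=
            le_mul_of_one_le_right (by positivity) (by nlinarith)
        _ = _ := by ring
    calc k ^ 2 * (p * (K * l) * (K * l + K * l * (K * l * n * p))) * M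
        = K ^ 2 * (k ^ 2 * p * l ^ 2 * M) + K ^ 3 * ((k * p) ^ 2 * (l ^ 3 * n) * M) := by ring
      _ ≤ K ^ 2 * ((k * p) ^ 2 * (l ^ 3 * n) * M) +
          K ^ 3 * ((k * p) ^ 2 * (l ^ 3 * n) * M) := by gcongr
      _ ≤ K ^ 2 * 1 + K ^ 3 * 1 := by gcongr
      _ = _ := by ring
  calc _ ≤ 2 * K ^ 2 / M + (K ^ 2 + K ^ 3) / M := add_le_add h1 h2
    _ = _ := by ring

/-- The fixed point inequality for the total progeny of a Poisson branching process of mean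
`lam < 1`, at the optimal point `z = 1 / lam`. -/
theorem branching_supersolution {lam q : ℝ} {n : ℕ} (h0 : 0 < lam) (h1 : lam < 1) (hq0 : 0 ≤ q)
    (hq : q ≤ lam / n) :
    Real.exp (lam - 1) / lam * (1 + q * (1 / lam - 1)) ^ n ≤ 1 / lam := by
  have hz : 0 ≤ 1 / lam - 1 := by
    rw [sub_nonneg, le_div_iff₀ h0]
    linarith
  have hnq : n * q ≤ lam := by
    rcases Nat.eq_zero_or_pos n with rfl | hn
    · simpa using h0.le
    · have : (0 : ℝ) < n := by exact_mod_cast hn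
      rw [le_div_iff₀ this] at hq
      linarith
  have hpow : (1 + q * (1 / lam - 1)) ^ n ≤ Real.exp (1 - lam) := by
    calc (1 + q * (1 / lam - 1)) ^ n ≤ Real.exp (q * (1 / lam - 1)) ^ n := by
          gcongr
          linarith [Real.add_one_le_exp (q * (1 / lam - 1))]
      _ = Real.exp (n * q * (1 / lam - 1)) := by rw [← Real.exp_nat_mul]; ring_nf
      _ ≤ Real.exp (lam * (1 / lam - 1)) := by gcongr
      _ = Real.exp (1 - lam) := by
          congr 1
          field_simp
  calc _ ≤ Real.exp (lam - 1) / lam * Real.exp (1 - lam) := by gcongr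
    _ = Real.exp (lam - 1) * Real.exp (1 - lam) / lam := by ring
    _ = 1 / lam := by
        rw [← Real.exp_add]
        simp

end Numerics

end PathQuery

theorem mainTheorem1 :
    ∃ c : ℝ, 0 < c ∧ ∀ lam : ℝ, 0 < lam → lam < 1 →
      ∃ δ : ℕ → ℝ, Tendsto δ atTop (𝓝 0) ∧
        ∀ (n : ℕ) (p η : unitInterval),
          1.5 * Real.log n / n ≤ (p : ℝ) → (p : ℝ) * (η : ℝ) ≤ lam / n →
          ∀ s t : Fin n, s ≠ t → ∀ A : PathQuery.RandomizedAlgorithm n,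
            ENNReal.ofReal (c / ((p : ℝ) * Real.log n ^ 2 * Real.sqrt n)) ≤
                PathQuery.expectedQueries p η A ∨
              (PathQuery.successProb p η s t A).toReal ≤ (p : ℝ) * Real.log n ^ 2 + δ n := by
  refine ⟨1, one_pos, fun lam h0 h1 => ?_⟩
  set z : ℝ := 1 / lam with hz
  set θ : ℝ := Real.exp (lam - 1) / lam with hθ
  have hz1 : 1 ≤ z := by
    rw [hz, le_div_iff₀ h0]
    linarith
  have hθ1 : 1 < θ := by
    rw [hθ, lt_div_iff₀ h0, one_mul]
    have := Real.add_one_lt_exp (x := lam - 1) (by linarith)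
    linarith
  have hlogθ : 0 < Real.log θ := Real.log_pos hθ1
  -- components of the prior graph have at most `K * log n` vertices with high probability
  set K : ℝ := 2 / Real.log θ with hK
  have hK0 : 0 < K := by positivity
  set D : ℝ := 1 + z + z / (θ - 1) + (3 * K ^ 2 + K ^ 3) with hD
  refine ⟨fun n => if n < 3 then 1 else D / Real.sqrt (Real.sqrt (Real.log n)), ?_, ?_⟩
  · have hlim : Tendsto (fun n : ℕ => D / Real.sqrt (Real.sqrt (Real.log n))) atTop (𝓝 0) :=
      ((Real.tendsto_sqrt_atTop.comp (Real.tendsto_sqrt_atTop.comp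
        (Real.tendsto_log_atTop.comp tendsto_natCast_atTop_atTop)))).const_div_atTop D
    refine hlim.congr' ?_
    filter_upwards [eventually_ge_atTop 3] with n hn
    rw [if_neg (by omega)]
  intro n p η hp hq s t hst A
  have hp0 : (0 : ℝ) ≤ p := p.2.1
  refine or_iff_not_imp_left.2 fun hlt => ?_
  rw [not_le] at hlt
  by_cases hn : n < 3
  · have h := ENNReal.toReal_mono ENNReal.one_ne_top (PathQuery.successProb_le_one p η s t A)
    rw [ENNReal.toReal_one] at h
    simp only [hn, if_true]
    nlinarith [mul_nonneg hp0 (sq_nonneg (Real.log n))]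
  simp only [hn, if_false]
  have hn3 : (3 : ℝ) ≤ n := by exact_mod_cast not_lt.1 hn
  have hn0 : (0 : ℝ) < n := by linarith
  have hl1 : 1 ≤ Real.log n := by
    rw [Real.le_log_iff_exp_le hn0]
    linarith [Real.exp_one_lt_d9]
  set l := Real.log n with hl
  set M := Real.sqrt (Real.sqrt l) with hM
  have hM1 : 1 ≤ M := Real.one_le_sqrt.2 (Real.one_le_sqrt.2 hl1)
  have hM4 : M ^ 4 = l := by
    rw [show M ^ 4 = (M ^ 2) ^ 2 by ring, hM, Real.sq_sqrt (Real.sqrt_nonneg _),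
      Real.sq_sqrt (by linarith)]
  have hMl : M ≤ l := hM4 ▸ le_self_pow₀ hM1 (by norm_num)
  have hln : l ≤ n - 1 := Real.log_le_sub_one_of_pos hn0
  have hppos : (0 : ℝ) < p := lt_of_lt_of_le (by positivity) hp
  set B : ℝ := 1 / ((p : ℝ) * l ^ 2 * Real.sqrt n) with hB
  have hB0 : 0 < B := by
    have := Real.sqrt_pos.2 hn0
    positivity
  -- by Markov's inequality, more than `M` times the expected number of queries are rare
  set k : ℕ := ⌊M * B⌋₊ with hk
  have hkle : (k : ℝ) ≤ M * B := Nat.floor_le (by positivity)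
  have hklt : M * B < k + 1 := Nat.lt_floor_add_one _
  have hL0 : 0 ≤ K * l := by positivity
  have hzθ : θ * (1 + (p : ℝ) * η * (z - 1)) ^ Fintype.card (Fin n) ≤ z := by
    rw [Fintype.card_fin]
    exact PathQuery.branching_supersolution h0 h1 (mul_nonneg p.2.1 η.2.1) hq
  have hlarge : PathQuery.pairProb p η (PathQuery.largeComponent (Fin n) (K * l)) ≤ z / M := by
    have hexp : (n : ℝ) ^ 2 ≤ Real.exp (K * l * Real.log θ) := by
      have : K * l * Real.log θ = (2 : ℕ) * l := by
        rw [hK]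
        field_simp
        simp
      rw [this, Real.exp_nat_mul, hl, Real.exp_log hn0]
    have h := PathQuery.pairProb_largeComponent_le p η hz1 hθ1 hzθ hexp
    rw [Fintype.card_fin] at h
    rw [le_div_iff₀ (by linarith)]
    have hnn := PathQuery.pairProb_nonneg p η (PathQuery.largeComponent (Fin n) (K * l))
    have h' : n * PathQuery.pairProb p η (PathQuery.largeComponent (Fin n) (K * l)) ≤ z := by
      refine le_of_mul_le_mul_left ?_ hn0
      linarith
    nlinarith
  have hreach : PathQuery.pairProb p η {ω : SimpleGraph (Fin n) × SimpleGraph (Fin n) |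
      (ω.1 ⊓ ω.2).Reachable s t} ≤ z / (θ - 1) / M := by
    have h := PathQuery.pairProb_reachable_le p η hz1 hθ1 hzθ hst
    rw [Fintype.card_fin] at h
    rw [le_div_iff₀ (by linarith)]
    have hnn := PathQuery.pairProb_nonneg p η {ω : SimpleGraph (Fin n) × SimpleGraph (Fin n) |
      (ω.1 ⊓ ω.2).Reachable s t}
    nlinarith
  have hconn := PathQuery.connection_bound hK0.le hn0 hl1 hp hM1 hM4 (Nat.cast_nonneg k) hkle
  have hmain := PathQuery.successProb_le p η (s := s) (t := t) hL0 A k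
  have hquery : PathQuery.expectedQueries p η A / (k + 1) ≤ ENNReal.ofReal (1 / M) := by
    rw [ENNReal.div_le_iff (by simp) (by finiteness)]
    have hcast : ((k : ℝ≥0∞) + 1) = ENNReal.ofReal ((k : ℝ) + 1) := by
      rw [ENNReal.ofReal_add (by positivity) zero_le_one]
      simp
    rw [hcast, ← ENNReal.ofReal_mul (by positivity)]
    refine hlt.le.trans (ENNReal.ofReal_le_ofReal ?_)
    rw [one_div_mul_eq_div, le_div_iff₀ (by linarith)]
    linarith
  have hfin := hmain.trans (add_le_add_left hquery _)
  rw [← ENNReal.ofReal_add (by positivity) (by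
    have h2 := PathQuery.pairProb_nonneg p η (PathQuery.largeComponent (Fin n) (K * l))
    have h3 := PathQuery.pairProb_nonneg p η {ω : SimpleGraph (Fin n) × SimpleGraph (Fin n) |
      (ω.1 ⊓ ω.2).Reachable s t}
    positivity)] at hfin
  have hDM : D / M = 1 / M + (z / M + z / (θ - 1) / M + (3 * K ^ 2 + K ^ 3) / M) := by
    rw [hD]
    ring
  have hpl : (p : ℝ) ≤ p * l ^ 2 := le_mul_of_one_le_right hp0 (one_le_pow₀ hl1)
  refine ENNReal.toReal_le_of_le_ofReal ?_ (hfin.trans (ENNReal.ofReal_le_ofReal ?_))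
  · have : 0 < θ - 1 := by linarith
    positivity
  · rw [hDM]
    linarith
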